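/- For $k\ge 1$ and $x,\theta>0$ let $\psi_k(x,\theta)=\frac{k}{\theta}\left(1-\frac{x}{\theta}\right)_+^{k-1}$ (for $k=1$ the uniform density on $(0,\theta)$). For each sample size $n$ let $k=k_n\ge 1$ and $J_0=J_{0,n}\ge 1$ be integers, possibly depending on $n$, with $\max(\log k,\log J_0)\lesssim\log n$, and let the true density on $(0,1)$ be $$g_0(x)=\sum_{j=0}^{k-1}\beta_{0,j}\,\psi_{j+1}(x,1)+\beta_{0,k}\sum_{l=1}^{J_0}w^0_l\,\psi_k(x,\theta^0_l),$$ where $(\beta_{0,0},\dots,\beta_{0,k})$ and $(w^0_1,\dots,w^0_{J_0})$ are probability vectors, $\beta_{0,0}>0$ and $\theta^0_l\in(0,1)$; if the support points vary with $n$, they are assumed to satisfy $\theta^0_l\ge n^{-2}$ for all large $n$ (which is automatic for points that do not depend on $n$). Let $X_1,\dots,X_n$ be i.i.d. with density $g_0$. Consider the prior on densities $g(x)=\sum_{j=0}^{k-1}\beta_j\psi_{j+1}(x,1)+\beta_k\int\psi_k(x,\theta)\,dQ(\theta)$ under which $(\beta_0,\dots,\beta_k)\sim\mathrm{Dir}(a_0,\dots,a_k)$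 and, independently, $Q=\sum_{l=1}^J w_l\delta_{\theta_l}$, where $\Pi(J)=(n^c-1)n^{-cJ}$ for $J=1,2,\dots$ and, given $J$, independently $(w_1,\dots,w_J)\sim\mathrm{Dir}(\omega_{1J},\dots,\omega_{JJ})$ and $\theta_1,\dots,\theta_J$ are i.i.d. from a probability measure $H=H_n$ on $(0,1)$ with Lebesgue density $p_H$. The Dirichlet parameters are positive; for the values $k=k_n$ and $J_0=J_{0,n}$ that occur, $a_0,\dots,a_k$ lie between two fixed positive numbers, and $\omega_{1J_0},\dots,\omega_{J_0J_0}$ lie between a fixed positive multiple of $J_0^{-b}$, for some fixed $b$, and a fixed number (both are automatic when $k$ and $J_0$ do not depend on $n$). For constants $t_2,t_3>0$, and with implied positive constants that do not depend on $n$, suppose that for all large $n$ $$H((u,v))\gtrsim (v-u)^{t_2}\ \text{ for all intervals }(u,v)\subset(n^{-2},1),\qquad p_H(\theta)\lesssim e^{-t_3/\theta}\ \text{ for all }\theta\in(0,n^{-2}).$$ Then there is $c_*>0$, depending only on the constants in these hypotheses, such that for every $c\ge c_*$ the posterior contracts at $g_0$ in the Hellinger distance $d_H(p,q)=\|\sqrt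 p-\sqrt q\|_2$ at the rate $\epsilon_n=\sqrt{\max(k,J_0)(\log n)/n}$, that is, for every sequence $M_n\to\infty$, $$\mathrm E_{g_0}\big[\Pi\big(d_H(g,g_0)\ge M_n\epsilon_n\mid X_1,\dots,X_n\big)\big]\to 0 .$$ -/

import Mathlib

open MeasureTheory ProbabilityTheory Filter Set
open scoped ENNReal Topology

namespace KMonotone

/-- The scaled `Beta(1, k)` kernel `ψ_k(x, θ) = (k / θ) (1 - x / θ)_+ ^ (k - 1)`, `x, θ > 0`.
For `k = 1` it is the uniform density on `(0, θ)`, so the positive part is written as a case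
distinction (in Lean `0 ^ 0 = 1`). -/
noncomputable def psi (k : ℕ) (x θ : ℝ) : ℝ :=
  if 0 < x ∧ x < θ then (k / θ) * (1 - x / θ) ^ (k - 1) else 0

/-- The density
`x ↦ ∑_{j < k} β_j ψ_{j+1}(x, 1) + β_k ∑_l w_l ψ_k(x, θ_l)`,
that is, polynomial part plus the `ψ_k`-mixture with mixing distribution `∑_l w_l δ_{θ_l}`. -/
noncomputable def mixDensity {k J : ℕ} (β : Fin (k + 1) → ℝ) (w θ : Fin J → ℝ) (x : ℝ) : ℝ :=
  (∑ j : Fin k, β j.castSucc * psi (j + 1) x 1) + β (Fin.last k) * ∑ l, w l * psi k x (θ l)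

/-- Hellinger distance `‖√p - √q‖₂` of two densities on `(0, 1)`. -/
noncomputable def hellinger (p q : ℝ → ℝ) : ℝ :=
  √(∫ x in Ioo (0 : ℝ) 1, (√(p x) - √(q x)) ^ 2)

/-- The probability law on the line with Lebesgue density `p`. -/
noncomputable def law (p : ℝ → ℝ) : Measure ℝ :=
  volume.withDensity fun x => ENNReal.ofReal (p x)

/-- The Dirichlet distribution `Dir(m; α_1, …, α_m)`: the law of `(Y_1, …, Y_m) / (Y_1 + ⋯ + Y_m)`
for independent `Y_j` with `Gamma(α_j, 1)` distributions. -/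
noncomputable def dirichlet {m : ℕ} (α : Fin m → ℝ) : Measure (Fin m → ℝ) :=
  (Measure.pi fun j => gammaMeasure (α j) 1).map fun y j => y j / ∑ i, y i

/-- Finitely supported mixing distributions `∑_{l ≤ J} w_l δ_{θ_l}`, recorded as `(J, (w, θ))`. -/
abbrev Mixing : Type := Σ J : ℕ, (Fin J → ℝ) × (Fin J → ℝ)

/-- The prior probability `(n ^ c - 1) n ^ (-c J)` of `J` support points, `J = 1, 2, …`. -/
noncomputable def compWeight (n : ℕ) (c : ℝ) (J : ℕ) : ℝ≥0∞ :=
  if J = 0 then 0 else ENNReal.ofReal (((n : ℝ) ^ c - 1) * (n : ℝ) ^ (-(c * J)))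

/-- The finite mixture prior on the mixing distribution: `J` has the law `compWeight n c`, and,
given `J`, independently `w ∼ Dir(J; ω_{1J}, …, ω_{JJ})` and `θ_1, …, θ_J` i.i.d. from `H`. -/
noncomputable def mixingPrior (n : ℕ) (c : ℝ) (ω : ∀ J : ℕ, Fin J → ℝ) (H : Measure ℝ) :
    Measure Mixing :=
  Measure.sum fun J : ℕ =>
    compWeight n c J • ((dirichlet (ω J)).prod (Measure.pi fun _ : Fin J => H)).map (Sigma.mk J)

/-- The parameter `(β, (J, (w, θ)))` of a density of the model of order `k`. -/
abbrev Param (k : ℕ) : Type := (Fin (k + 1) → ℝ) × Mixing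

/-- The density with a given parameter. -/
noncomputable def Param.density {k : ℕ} (ξ : Param k) : ℝ → ℝ :=
  mixDensity ξ.1 ξ.2.2.1 ξ.2.2.2

/-- The prior: `β ∼ Dir(k + 1; a_0, …, a_k)`, independently of the mixing distribution. -/
noncomputable def prior {k : ℕ} (n : ℕ) (c : ℝ) (a : Fin (k + 1) → ℝ) (ω : ∀ J : ℕ, Fin J → ℝ)
    (H : Measure ℝ) : Measure (Param k) :=
  (dirichlet a).prod (mixingPrior n c ω H)

/-- Bayes' formula: the posterior probability of a set `B` of parameters, given the i.i.d.
observations `x_1, …, x_n` from the density `p ξ`, under the prior `P` on `ξ`. -/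
noncomputable def posterior {Ξ : Type*} [MeasurableSpace Ξ] (P : Measure Ξ) (p : Ξ → ℝ → ℝ)
    {n : ℕ} (x : Fin n → ℝ) (B : Set Ξ) : ℝ≥0∞ :=
  (∫⁻ ξ in B, ∏ i, ENNReal.ofReal (p ξ (x i)) ∂P) / ∫⁻ ξ, ∏ i, ENNReal.ofReal (p ξ (x i)) ∂P

/-- Posterior contraction in the Hellinger distance at the truths `g₀ n` (sample size `n`, model of
order `k n`, prior `P n`) at the rate `ε n`:
`E₀ Π(d_H(g, g₀) ≥ M_n ε_n | X_1, …, X_n) → 0` for every `M_n → ∞`. -/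
def ContractsAt (k : ℕ → ℕ) (P : ∀ n, Measure (Param (k n))) (g₀ : ℕ → ℝ → ℝ) (ε : ℕ → ℝ) : Prop :=
  ∀ M : ℕ → ℝ, Tendsto M atTop atTop →
    Tendsto
      (fun n => ∫⁻ x : Fin n → ℝ,
        posterior (P n) Param.density x {ξ | M n * ε n ≤ hellinger ξ.density (g₀ n)}
        ∂(Measure.pi fun _ : Fin n => law (g₀ n)))
      atTop (𝓝 0)

end KMonotone

/-!
No tests are needed: all comparisons between densities are pointwise, because the kernels satisfy
`ψ_k(x, θ) ≤ (θ' / θ) ψ_k(x, θ')` for `θ ≤ θ'` (`psi_le_mul_psi`).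
Write `m = max k J₀` and `T = m log n = n ε_n²`.

*Marginal likelihood.* If each coefficient and each weight is at least `(1 + 1/n)⁻¹` times its
target and each support point is moved up by at most a factor `1 + 1/n`, then
`g ≥ (1 + 1/n)⁻³ g₀` everywhere, so that the likelihood ratio is at least `e⁻³` for every sample.
Support points that would leave `(0, 1)` are absorbed by the polynomial component `ψ_k(·, 1)`
(`exists_dominating`). The prior mass of such parameters is at least `e ^ (-D T)`
(`exp_le_prior_dominating`), by a bound for Dirichlet distributions in terms of the independent
gamma variables that define them (`le_dirichlet`).

*Sieve.* Parameters with more than `Λ m` support points, or with a support point below `n⁻²`, have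
prior mass at most `2 e ^ (-(D + 1) T)` (`prior_compl_sieve_le_exp`), and contribute at most
`2 e ^ (-T)` to the expected posterior mass by Tonelli's theorem.

*Brackets.* Rounding all parameters up to a grid of mesh `n⁻⁶` gives `e ^ (E T)` functions `U`, one
of which dominates a given density of the sieve and has mass at most `1 + n⁻²` (`exists_bracket`,
`card_bracketIndex_le_exp`). If the dominated density is at Hellinger distance at least `r` from
`g₀`, then `∫ √(U g₀) ≤ 1 - r² / 2 + 1 / n` (`lintegral_sqrt_mul_le`). As a posterior probability
is at most one, it is at most its square root, and the expectation of the square root of the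
likelihood ratio of `U` is the `n`-th power of that affinity (`lintegral_posterior_le`). For
`r = M_n ε_n` this is at most `e ^ (1 - M_n² T / 2)`, which beats the number of brackets and the
bound for the marginal likelihood as soon as `M_n` is large.

If `M_n ε_n > √2`, the posterior mass vanishes since the Hellinger distance is at most `√2`;
otherwise `m ≤ n`, which is what the polynomial bounds above need.
-/

namespace KMonotone

/-! ### A bound on the expected posterior probability -/

theorem lintegral_pi_prod {n : ℕ} (μ : Measure ℝ) [SigmaFinite μ] {f : ℝ → ℝ≥0∞}
    (hf : Measurable f) :
    ∫⁻ x : Fin n → ℝ, ∏ i, f (x i) ∂(Measure.pi fun _ => μ) = (∫⁻ y, f y ∂μ) ^ n := by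
  induction n with
  | zero => simp
  | succ n ih =>
    have h := (measurePreserving_piFinSuccAbove (fun _ : Fin (n + 1) => μ) 0).symm
    rw [← h.lintegral_comp_emb (MeasurableEquiv.measurableEmbedding _)]
    simp only [Fin.prod_univ_succ]
    have : ∀ a : ℝ × (Fin n → ℝ), f ((MeasurableEquiv.piFinSuccAbove (fun _ => ℝ) 0).symm a 0) *
        ∏ i : Fin n, f ((MeasurableEquiv.piFinSuccAbove (fun _ => ℝ) 0).symm a i.succ)
        = f a.1 * ∏ i, f (a.2 i) := by
      intro a
      simp [MeasurableEquiv.piFinSuccAbove]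
    simp_rw [this]
    have hm : Measurable fun y : Fin n → ℝ => ∏ i, f (y i) :=
      Finset.measurable_prod _ fun i _ => hf.comp (measurable_pi_apply i)
    rw [lintegral_prod_mul hf.aemeasurable hm.aemeasurable, ih, pow_succ']

theorem sum_rpow_half_le_sum {ι : Type*} (s : Finset ι) (f : ι → ℝ≥0∞) :
    (∑ i ∈ s, f i) ^ (1 / 2 : ℝ) ≤ ∑ i ∈ s, f i ^ (1 / 2 : ℝ) := by
  refine Finset.le_sum_of_subadditive (fun y : ℝ≥0∞ => y ^ (1 / 2 : ℝ)) ?_ ?_ s f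
  · simp
  · intro x y
    exact ENNReal.rpow_add_le_add_rpow x y (by norm_num) (by norm_num)

theorem le_rpow_half_of_le_one {a : ℝ≥0∞} (ha : a ≤ 1) : a ≤ a ^ (1 / 2 : ℝ) := by
  have := ENNReal.rpow_le_rpow_of_exponent_ge ha (by norm_num : (1 / 2 : ℝ) ≤ 1)
  simpa using this

theorem lintegral_law {g₀ : ℝ → ℝ} (hg₀ : Measurable g₀) {f : ℝ → ℝ≥0∞} (hf : Measurable f) :
    ∫⁻ x, f x ∂(law g₀) = ∫⁻ x, ENNReal.ofReal (g₀ x) * f x := by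
  rw [law, lintegral_withDensity_eq_lintegral_mul _ hg₀.ennreal_ofReal hf]
  rfl

/-- Division by the density of the law undoes the change of measure, up to the zeros of the
density, where the left hand side vanishes. -/
theorem lintegral_law_div_le {g₀ : ℝ → ℝ} (hg₀ : Measurable g₀) {q : ℝ → ℝ≥0∞}
    (hq : Measurable q) :
    ∫⁻ x, q x / ENNReal.ofReal (g₀ x) ∂(law g₀) ≤ ∫⁻ x, q x := by
  rw [lintegral_law hg₀ (f := fun x => q x / ENNReal.ofReal (g₀ x)) (hq.div hg₀.ennreal_ofReal)]
  exact lintegral_mono fun x => ENNReal.mul_div_le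

/-- The expected root of a likelihood ratio is at most the affinity. -/
theorem lintegral_law_sqrt_div_le {g₀ : ℝ → ℝ} (hg₀ : Measurable g₀) {q : ℝ → ℝ≥0∞}
    (hq : Measurable q) :
    ∫⁻ x, (q x / ENNReal.ofReal (g₀ x)) ^ (1 / 2 : ℝ) ∂(law g₀) ≤
      ∫⁻ x, (q x * ENNReal.ofReal (g₀ x)) ^ (1 / 2 : ℝ) := by
  rw [lintegral_law hg₀ (f := fun x => (q x / ENNReal.ofReal (g₀ x)) ^ (1 / 2 : ℝ))
    ((hq.div hg₀.ennreal_ofReal).pow_const _)]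
  refine lintegral_mono fun x => ?_
  generalize ENNReal.ofReal (g₀ x) = b
  have hb : b = (b * b) ^ (1 / 2 : ℝ) := by
    rw [← pow_two, ← ENNReal.rpow_natCast, ← ENNReal.rpow_mul]
    norm_num
  nth_rewrite 1 [hb]
  rw [← ENNReal.mul_rpow_of_nonneg _ _ (by norm_num), mul_assoc, mul_comm (q x)]
  gcongr
  exact ENNReal.mul_div_le

/-- The expected posterior probability of a set `B`, in terms of
* a pointwise lower bound `κ ∏ g₀ (x_i)` for the marginal likelihood,
* finitely many functions `U i`, one of which dominates `p ξ` for each `ξ ∈ B ∩ V`, with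
  affinities `∫ √(U i g₀)` at most `ρ`,
* the prior probability of the complement of the sieve `V`.

As a posterior probability is at most `1`, it is at most its own square root, and the square root
turns the likelihood ratio of `U i` into the `n`-th power of an affinity. -/
theorem lintegral_posterior_le {Ξ : Type*} [MeasurableSpace Ξ] {P : Measure Ξ} [SFinite P]
    (hP : P univ ≤ 1) {p : Ξ → ℝ → ℝ} (hp : Measurable (Function.uncurry p))
    (hpP : ∀ᵐ ξ ∂P, ∫⁻ x, ENNReal.ofReal (p ξ x) ≤ 1) {g₀ : ℝ → ℝ} (hg₀ : Measurable g₀)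
    (hg₁ : ∫⁻ x, ENNReal.ofReal (g₀ x) = 1) {n : ℕ} {κ ρ : ℝ≥0∞} (hκ_top : κ ≠ ⊤)
    (hκ : ∀ x : Fin n → ℝ, κ * ∏ i, ENNReal.ofReal (g₀ (x i)) ≤
      ∫⁻ ξ, ∏ i, ENNReal.ofReal (p ξ (x i)) ∂P)
    {B V : Set Ξ} {ι : Type*} [Fintype ι] {U : ι → ℝ → ℝ} (hU : ∀ i, Measurable (U i))
    (hBV : ∀ ξ ∈ B ∩ V, ∃ i, (∀ x, p ξ x ≤ U i x) ∧
      ∫⁻ x, (ENNReal.ofReal (U i x) * ENNReal.ofReal (g₀ x)) ^ (1 / 2 : ℝ) ≤ ρ) :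
    ∫⁻ x : Fin n → ℝ, posterior P p x B ∂(Measure.pi fun _ : Fin n => law g₀) ≤
      Fintype.card ι * κ⁻¹ ^ (1 / 2 : ℝ) * ρ ^ n + κ⁻¹ * P Vᶜ := by
  classical
  have : IsProbabilityMeasure (law g₀) := ⟨by simp [law, hg₁]⟩
  set T := toMeasurable P Vᶜ with hT
  have hTm : MeasurableSet T := measurableSet_toMeasurable _ _
  set s : Finset ι := Finset.univ.filter fun i =>
    ∫⁻ x, (ENNReal.ofReal (U i x) * ENNReal.ofReal (g₀ x)) ^ (1 / 2 : ℝ) ≤ ρ with hs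
  -- the likelihood, jointly measurable
  have hL : Measurable fun z : Ξ × (Fin n → ℝ) => ∏ i, ENNReal.ofReal (p z.1 (z.2 i)) := by
    refine Finset.measurable_prod _ fun i _ => Measurable.ennreal_ofReal ?_
    exact hp.comp (measurable_fst.prodMk ((measurable_pi_apply i).comp measurable_snd))
  have hLx : ∀ x : Fin n → ℝ, Measurable fun ξ => ∏ i, ENNReal.ofReal (p ξ (x i)) :=
    fun x => hL.comp measurable_prodMk_right
  have hpξ : ∀ ξ, Measurable (p ξ) := fun ξ => hp.comp measurable_prodMk_left
  -- the numerator of the posterior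
  have hnum : ∀ x : Fin n → ℝ, ∫⁻ ξ in B, ∏ i, ENNReal.ofReal (p ξ (x i)) ∂P ≤
      (∑ j ∈ s, ∏ i, ENNReal.ofReal (U j (x i))) +
        ∫⁻ ξ in T, ∏ i, ENNReal.ofReal (p ξ (x i)) ∂P := by
    intro x
    set K := ∑ j ∈ s, ∏ i, ENNReal.ofReal (U j (x i)) with hK
    have hm : Measurable fun ξ => K + T.indicator (fun ξ => ∏ i, ENNReal.ofReal (p ξ (x i))) ξ :=
      measurable_const.add ((hLx x).indicator hTm)
    have hle : ∀ᵐ ξ ∂(P.restrict B), ∏ i, ENNReal.ofReal (p ξ (x i)) ≤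
        K + T.indicator (fun ξ => ∏ i, ENNReal.ofReal (p ξ (x i))) ξ := by
      rw [ae_restrict_iff (measurableSet_le (hLx x) hm)]
      refine ae_of_all _ fun ξ hξ => ?_
      by_cases hξT : ξ ∈ T
      · rw [indicator_of_mem hξT]
        exact le_add_self
      · have hξV : ξ ∈ V := by
          by_contra h
          exact hξT (subset_toMeasurable P Vᶜ h)
        obtain ⟨j, hj, hjρ⟩ := hBV ξ ⟨hξ, hξV⟩
        refine le_trans ?_ le_self_add
        refine le_trans ?_ (Finset.single_le_sum (f := fun j => ∏ i, ENNReal.ofReal (U j (x i)))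
          (fun _ _ => zero_le) (Finset.mem_filter.2 ⟨Finset.mem_univ j, hjρ⟩))
        exact Finset.prod_le_prod' fun i _ => ENNReal.ofReal_le_ofReal (hj _)
    calc ∫⁻ ξ in B, ∏ i, ENNReal.ofReal (p ξ (x i)) ∂P
        ≤ ∫⁻ ξ in B, K + T.indicator (fun ξ => ∏ i, ENNReal.ofReal (p ξ (x i))) ξ ∂P :=
          lintegral_mono_ae hle
      _ ≤ ∫⁻ ξ, K + T.indicator (fun ξ => ∏ i, ENNReal.ofReal (p ξ (x i))) ξ ∂P :=
          setLIntegral_le_lintegral _ _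
      _ = K * P univ + ∫⁻ ξ in T, ∏ i, ENNReal.ofReal (p ξ (x i)) ∂P := by
          rw [lintegral_add_left measurable_const, lintegral_const, lintegral_indicator hTm]
      _ ≤ _ := by
          gcongr
          exact mul_le_of_le_one_right' hP
  have hprod_top : ∀ x : Fin n → ℝ, ∏ i, ENNReal.ofReal (g₀ (x i)) ≠ ⊤ := fun x =>
    ENNReal.prod_ne_top fun i _ => ENNReal.ofReal_ne_top
  have hdiv : ∀ (x : Fin n → ℝ) (a : Fin n → ℝ≥0∞),
      (∏ i, a i) / (κ * ∏ i, ENNReal.ofReal (g₀ (x i))) =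
        κ⁻¹ * ∏ i, a i / ENNReal.ofReal (g₀ (x i)) := by
    intro x a
    rw [div_eq_mul_inv, ENNReal.mul_inv (Or.inr (hprod_top x)) (Or.inl hκ_top),
      ENNReal.prod_inv_distrib fun i _ j _ _ => Or.inr ENNReal.ofReal_ne_top]
    simp_rw [div_eq_mul_inv]
    rw [Finset.prod_mul_distrib]
    ring
  -- pointwise bound for the posterior
  have hpost : ∀ x : Fin n → ℝ, posterior P p x B ≤
      (∑ j ∈ s, κ⁻¹ ^ (1 / 2 : ℝ) *
        ∏ i, (ENNReal.ofReal (U j (x i)) / ENNReal.ofReal (g₀ (x i))) ^ (1 / 2 : ℝ)) +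
      κ⁻¹ * ∫⁻ ξ in T, ∏ i, (ENNReal.ofReal (p ξ (x i)) / ENNReal.ofReal (g₀ (x i))) ∂P := by
    intro x
    set D := κ * ∏ i, ENNReal.ofReal (g₀ (x i)) with hD
    have h1 : posterior P p x B ≤ 1 :=
      ENNReal.div_le_of_le_mul (by
        rw [one_mul]
        exact setLIntegral_le_lintegral _ _)
    have h2 : posterior P p x B ≤ (∑ j ∈ s, ∏ i, ENNReal.ofReal (U j (x i))) / D +
        (∫⁻ ξ in T, ∏ i, ENNReal.ofReal (p ξ (x i)) ∂P) / D := by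
      rw [← ENNReal.add_div]
      exact (ENNReal.div_le_div_left (hκ x) _).trans (ENNReal.div_le_div_right (hnum x) _)
    -- `min 1 (a + b) ≤ √a + b`
    have h3 : posterior P p x B ≤
        ((∑ j ∈ s, ∏ i, ENNReal.ofReal (U j (x i))) / D) ^ (1 / 2 : ℝ) +
        (∫⁻ ξ in T, ∏ i, ENNReal.ofReal (p ξ (x i)) ∂P) / D := by
      rcases le_total ((∑ j ∈ s, ∏ i, ENNReal.ofReal (U j (x i))) / D) 1 with h | h
      · exact h2.trans (add_le_add_left (le_rpow_half_of_le_one h) _)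
      · refine h1.trans (le_trans ?_ le_self_add)
        simpa using ENNReal.rpow_le_rpow h (by norm_num : (0 : ℝ) ≤ 1 / 2)
    refine h3.trans (add_le_add ?_ ?_)
    · simp_rw [div_eq_mul_inv _ D]
      rw [Finset.sum_mul]
      refine (sum_rpow_half_le_sum _ _).trans (Finset.sum_le_sum fun j _ => le_of_eq ?_)
      rw [← div_eq_mul_inv, hD, hdiv, ENNReal.mul_rpow_of_nonneg _ _ (by norm_num),
        ENNReal.prod_rpow_of_nonneg (by norm_num)]
    · rw [div_eq_mul_inv, ← lintegral_mul_const _ (hLx x), ← lintegral_const_mul]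
      · refine le_of_eq (lintegral_congr fun ξ => ?_)
        rw [← div_eq_mul_inv, hD, hdiv]
      · exact Finset.measurable_prod _ fun i _ =>
          ((hp.comp measurable_prodMk_right).ennreal_ofReal.div_const _)
  -- integration over the observations
  have hterm : ∀ j ∈ s, ∫⁻ x : Fin n → ℝ, κ⁻¹ ^ (1 / 2 : ℝ) *
      ∏ i, (ENNReal.ofReal (U j (x i)) / ENNReal.ofReal (g₀ (x i))) ^ (1 / 2 : ℝ)
      ∂(Measure.pi fun _ : Fin n => law g₀) ≤ κ⁻¹ ^ (1 / 2 : ℝ) * ρ ^ n := by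
    intro j hj
    have hm : Measurable fun y => (ENNReal.ofReal (U j y) / ENNReal.ofReal (g₀ y)) ^ (1 / 2 : ℝ) :=
      ((hU j).ennreal_ofReal.div hg₀.ennreal_ofReal).pow_const _
    have hm' : Measurable fun x : Fin n → ℝ =>
        ∏ i, (ENNReal.ofReal (U j (x i)) / ENNReal.ofReal (g₀ (x i))) ^ (1 / 2 : ℝ) :=
      Finset.measurable_prod _ fun i _ => hm.comp (measurable_pi_apply i)
    rw [lintegral_const_mul _ hm', lintegral_pi_prod (law g₀) hm]
    gcongr
    exact (lintegral_law_sqrt_div_le hg₀ (hU j).ennreal_ofReal).trans (Finset.mem_filter.1 hj).2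
  have hmj : ∀ j ∈ s, Measurable fun x : Fin n → ℝ => κ⁻¹ ^ (1 / 2 : ℝ) *
      ∏ i, (ENNReal.ofReal (U j (x i)) / ENNReal.ofReal (g₀ (x i))) ^ (1 / 2 : ℝ) := by
    intro j _
    refine measurable_const.mul (Finset.measurable_prod _ fun i _ => ?_)
    exact ((hU j).ennreal_ofReal.div hg₀.ennreal_ofReal).pow_const _ |>.comp (measurable_pi_apply i)
  have hLr : Measurable fun z : Ξ × (Fin n → ℝ) =>
      ∏ i, (ENNReal.ofReal (p z.1 (z.2 i)) / ENNReal.ofReal (g₀ (z.2 i))) := by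
    refine Finset.measurable_prod _ fun i _ => Measurable.div (Measurable.ennreal_ofReal ?_)
      (Measurable.ennreal_ofReal ?_)
    · exact hp.comp (measurable_fst.prodMk ((measurable_pi_apply i).comp measurable_snd))
    · exact hg₀.comp ((measurable_pi_apply i).comp measurable_snd)
  have hcompl : ∫⁻ x : Fin n → ℝ, κ⁻¹ *
      ∫⁻ ξ in T, ∏ i, (ENNReal.ofReal (p ξ (x i)) / ENNReal.ofReal (g₀ (x i))) ∂P
      ∂(Measure.pi fun _ : Fin n => law g₀) ≤ κ⁻¹ * P Vᶜ := by
    rw [lintegral_const_mul _ (hLr.lintegral_prod_left' (μ := P.restrict T))]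
    refine mul_le_mul_right ?_ _
    rw [lintegral_lintegral_swap (f := fun (x : Fin n → ℝ) ξ =>
      ∏ i, (ENNReal.ofReal (p ξ (x i)) / ENNReal.ofReal (g₀ (x i))))
      (hLr.comp measurable_swap).aemeasurable]
    calc ∫⁻ ξ in T, ∫⁻ x : Fin n → ℝ,
          ∏ i, (ENNReal.ofReal (p ξ (x i)) / ENNReal.ofReal (g₀ (x i)))
          ∂(Measure.pi fun _ : Fin n => law g₀) ∂P
        ≤ ∫⁻ _ in T, 1 ∂P := by
          refine lintegral_mono_ae ((ae_restrict_of_ae hpP).mono fun ξ hξ => ?_)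
          rw [lintegral_pi_prod (law g₀)
            (f := fun y => ENNReal.ofReal (p ξ y) / ENNReal.ofReal (g₀ y))
            ((hpξ ξ).ennreal_ofReal.div hg₀.ennreal_ofReal)]
          exact pow_le_one₀ zero_le
            ((lintegral_law_div_le hg₀ (hpξ ξ).ennreal_ofReal).trans hξ)
      _ = P Vᶜ := by simp [hT]
  calc ∫⁻ x : Fin n → ℝ, posterior P p x B ∂(Measure.pi fun _ : Fin n => law g₀)
      ≤ _ := lintegral_mono hpost
    _ = _ := lintegral_add_left (Finset.measurable_sum _ hmj) _
    _ ≤ (∑ _j ∈ s, κ⁻¹ ^ (1 / 2 : ℝ) * ρ ^ n) + κ⁻¹ * P Vᶜ := by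
        rw [lintegral_finsetSum _ hmj]
        exact add_le_add (Finset.sum_le_sum hterm) hcompl
    _ ≤ _ := by
        rw [Finset.sum_const, nsmul_eq_mul, ← mul_assoc]
        gcongr
        exact_mod_cast Finset.card_le_univ s

/-! ### The kernels `ψ_k` and their mixtures -/

theorem psi_nonneg (k : ℕ) (x θ : ℝ) : 0 ≤ psi k x θ := by
  unfold psi
  split_ifs with h
  · have hθ : 0 < θ := h.1.trans h.2
    have : 0 ≤ 1 - x / θ := by
      rw [sub_nonneg, div_le_one hθ]
      exact h.2.le
    positivity
  · exact le_rfl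

theorem measurable_psi (k : ℕ) : Measurable fun z : ℝ × ℝ => psi k z.1 z.2 := by
  refine Measurable.ite ?_ (by fun_prop) measurable_const
  exact (measurableSet_lt measurable_const measurable_fst).inter
    (measurableSet_lt measurable_fst measurable_snd)

theorem psi_eq_indicator (k : ℕ) (θ : ℝ) : (fun x => psi k x θ) =
    (Ioo 0 θ).indicator fun x => (k / θ) * (1 - x / θ) ^ (k - 1) := by
  ext x
  simp only [psi, indicator, mem_Ioo]

theorem integrable_psi (k : ℕ) (θ : ℝ) : Integrable fun x => psi k x θ := by
  rw [psi_eq_indicator, integrable_indicator_iff measurableSet_Ioo]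
  have : ContinuousOn (fun x : ℝ => (k / θ) * (1 - x / θ) ^ (k - 1)) (Icc 0 θ) := by fun_prop
  exact (this.integrableOn_Icc).mono_set Ioo_subset_Icc_self

theorem integral_psi {k : ℕ} (hk : 1 ≤ k) {θ : ℝ} (hθ : 0 < θ) : ∫ x, psi k x θ = 1 := by
  rw [psi_eq_indicator, integral_indicator measurableSet_Ioo, ← integral_Ioc_eq_integral_Ioo,
    ← intervalIntegral.integral_of_le hθ.le]
  have hd : ∀ x ∈ uIcc 0 θ, HasDerivAt (fun x : ℝ => -(1 - x / θ) ^ k)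
      ((k / θ) * (1 - x / θ) ^ (k - 1)) x := by
    intro x _
    have h := (((hasDerivAt_id x).div_const θ).const_sub 1).pow k |>.neg
    refine h.congr_deriv ?_
    simp
    ring
  rw [intervalIntegral.integral_eq_sub_of_hasDerivAt hd
    (Continuous.intervalIntegrable (by fun_prop) _ _)]
  have : k ≠ 0 := by omega
  simp [div_self hθ.ne', this]

/-- Up to the ratio of the scales, `ψ_k(·, θ)` increases with `θ`. -/
theorem psi_le_mul_psi (k : ℕ) (x : ℝ) {θ θ' : ℝ} (hθ : 0 < θ) (h : θ ≤ θ') :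
    psi k x θ ≤ θ' / θ * psi k x θ' := by
  by_cases hx : 0 < x ∧ x < θ
  · have hx' : 0 < x ∧ x < θ' := ⟨hx.1, hx.2.trans_le h⟩
    rw [psi, psi, if_pos hx, if_pos hx', ← mul_assoc]
    have hθ' : 0 < θ' := hθ.trans_le h
    have e : θ' / θ * (k / θ') = k / θ := by field_simp
    rw [e]
    have h0 : 0 ≤ 1 - x / θ := by
      rw [sub_nonneg, div_le_one hθ]
      exact hx.2.le
    have := hx.1.le
    gcongr
  · rw [psi, if_neg hx]
    have := psi_nonneg k x θ'
    have : 0 ≤ θ' := (hθ.trans_le h).le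
    positivity

section Mixture

variable {k J : ℕ} {β : Fin (k + 1) → ℝ} {w θ : Fin J → ℝ}

theorem mixDensity_nonneg (hβ : ∀ j, 0 ≤ β j) (hw : ∀ l, 0 ≤ w l) (θ : Fin J → ℝ) (x : ℝ) :
    0 ≤ mixDensity β w θ x := by
  unfold mixDensity
  refine add_nonneg (Finset.sum_nonneg fun j _ => mul_nonneg (hβ _) (psi_nonneg _ _ _))
    (mul_nonneg (hβ _) (Finset.sum_nonneg fun l _ => mul_nonneg (hw _) (psi_nonneg _ _ _)))

theorem integrable_mixDensity (β : Fin (k + 1) → ℝ) (w θ : Fin J → ℝ) :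
    Integrable (mixDensity β w θ) := by
  unfold mixDensity
  refine Integrable.add ?_ (Integrable.const_mul ?_ _)
  · exact integrable_finsetSum _ fun j _ => (integrable_psi _ _).const_mul _
  · exact integrable_finsetSum _ fun j _ => (integrable_psi _ _).const_mul _

theorem integral_mixDensity (hk : 1 ≤ k) (β : Fin (k + 1) → ℝ) (w : Fin J → ℝ)
    (hθ : ∀ l, 0 < θ l) :
    ∫ x, mixDensity β w θ x = (∑ j : Fin k, β j.castSucc) + β (Fin.last k) * ∑ l, w l := by
  unfold mixDensity
  rw [integral_add, integral_const_mul, integral_finsetSum, integral_finsetSum]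
  · simp_rw [integral_const_mul]
    congr 1
    · refine Finset.sum_congr rfl fun j _ => ?_
      rw [integral_psi (by omega) one_pos, mul_one]
    · congr 1
      refine Finset.sum_congr rfl fun l _ => ?_
      rw [integral_psi hk (hθ l), mul_one]
  · exact fun j _ => (integrable_psi _ _).const_mul _
  · exact fun j _ => (integrable_psi _ _).const_mul _
  · exact integrable_finsetSum _ fun j _ => (integrable_psi _ _).const_mul _
  · exact (integrable_finsetSum _ fun j _ => (integrable_psi _ _).const_mul _).const_mul _

theorem integral_mixDensity_eq_one (hk : 1 ≤ k) (hβ : β ∈ stdSimplex ℝ (Fin (k + 1)))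
    (hw : w ∈ stdSimplex ℝ (Fin J)) (hθ : ∀ l, 0 < θ l) : ∫ x, mixDensity β w θ x = 1 := by
  rw [integral_mixDensity hk _ _ hθ, hw.2, mul_one, ← Fin.sum_univ_castSucc, hβ.2]

theorem lintegral_mixDensity_eq_one (hk : 1 ≤ k) (hβ : β ∈ stdSimplex ℝ (Fin (k + 1)))
    (hw : w ∈ stdSimplex ℝ (Fin J)) (hθ : ∀ l, 0 < θ l) :
    ∫⁻ x, ENNReal.ofReal (mixDensity β w θ x) = 1 := by
  rw [← ofReal_integral_eq_lintegral_ofReal (integrable_mixDensity _ _ _)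
    (ae_of_all _ (mixDensity_nonneg hβ.1 hw.1 θ)), integral_mixDensity_eq_one hk hβ hw hθ,
    ENNReal.ofReal_one]

theorem measurable_mixDensity (β : Fin (k + 1) → ℝ) (w θ : Fin J → ℝ) :
    Measurable (mixDensity β w θ) := by
  have h : ∀ k θ, Measurable fun x => psi k x θ := fun k θ =>
    (measurable_psi k).comp measurable_prodMk_right
  unfold mixDensity
  refine Measurable.add (Finset.measurable_sum _ fun j _ => (h _ _).const_mul _)
    (Measurable.const_mul (Finset.measurable_sum _ fun j _ => (h _ _).const_mul _) _)

end Mixture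

/-- The map from the parameter and the observation to the density is jointly measurable. -/
theorem measurable_density (k : ℕ) :
    Measurable (Function.uncurry (Param.density : Param k → ℝ → ℝ)) := by
  -- the sum over the support points becomes a sum over `l < J` with a measurable `J`
  let W : ℕ → Mixing → ℝ := fun l s => if h : l < s.1 then s.2.1 ⟨l, h⟩ else 0
  let Θ : ℕ → Mixing → ℝ := fun l s => if h : l < s.1 then s.2.2 ⟨l, h⟩ else 0
  have hsig : ∀ {f : Mixing → ℝ}, (∀ J, Measurable fun p : (Fin J → ℝ) × (Fin J → ℝ) => f ⟨J, p⟩) →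
      Measurable f := by
    intro f hf s hs
    exact MeasurableSpace.measurableSet_iInf.2 fun J => hf J hs
  have hW : ∀ l, Measurable (W l) := fun l => hsig fun J => by
    by_cases h : l < J
    · simp only [W, h, dite_true]
      exact (measurable_pi_apply (⟨l, h⟩ : Fin J)).comp measurable_fst
    · simp only [W, h, dite_false]
      fun_prop
  have hΘ : ∀ l, Measurable (Θ l) := fun l => hsig fun J => by
    by_cases h : l < J
    · simp only [Θ, h, dite_true]
      exact (measurable_pi_apply (⟨l, h⟩ : Fin J)).comp measurable_snd
    · simp only [Θ, h, dite_false]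
      fun_prop
  have hJ : Measurable fun s : Mixing => s.1 := by
    intro s hs
    refine MeasurableSpace.measurableSet_iInf.2 fun J => ?_
    exact (measurable_const : Measurable fun _ : (Fin J → ℝ) × (Fin J → ℝ) => J) hs
  have hsum : Measurable fun z : ℕ × (Mixing × ℝ) =>
      ∑ l ∈ Finset.range z.1, W l z.2.1 * psi k z.2.2 (Θ l z.2.1) := by
    refine measurable_from_prod_countable_right fun m => ?_
    refine Finset.measurable_sum (Finset.range m)
      (f := fun l (y : Mixing × ℝ) => W l y.1 * psi k y.2 (Θ l y.1)) fun l _ => ?_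
    refine ((hW l).comp measurable_fst).mul ?_
    exact (measurable_psi k).comp (measurable_snd.prodMk ((hΘ l).comp measurable_fst))
  have heq : (Function.uncurry (Param.density : Param k → ℝ → ℝ)) = fun z =>
      (∑ j : Fin k, z.1.1 j.castSucc * psi (j + 1) z.2 1) + z.1.1 (Fin.last k) *
        ∑ l ∈ Finset.range z.1.2.1, W l z.1.2 * psi k z.2 (Θ l z.1.2) := by
    ext ⟨⟨β, J, w, θ⟩, x⟩
    simp only [Function.uncurry, Param.density, mixDensity]
    rw [Finset.sum_range]
    simp [W, Θ]
  rw [heq]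
  refine Measurable.add (Finset.measurable_sum _ fun j _ => ?_) (Measurable.mul (by fun_prop) ?_)
  · refine Measurable.mul (by fun_prop) ?_
    exact (measurable_psi _).comp (measurable_snd.prodMk measurable_const)
  · exact hsum.comp ((hJ.comp (measurable_snd.comp measurable_fst)).prodMk
      ((measurable_snd.comp measurable_fst).prodMk measurable_snd))

/-! ### The Hellinger distance and upper brackets -/

theorem sq_sqrt_sub_sqrt_le {a b : ℝ} (ha : 0 ≤ a) (hb : 0 ≤ b) : (√a - √b) ^ 2 ≤ a + b := by
  nlinarith [Real.sq_sqrt ha, Real.sq_sqrt hb, mul_nonneg (Real.sqrt_nonneg a) (Real.sqrt_nonneg b)]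

theorem integrable_sq_sqrt_sub_sqrt {f g : ℝ → ℝ} (hf : Integrable f) (hg : Integrable g)
    (hf0 : ∀ x, 0 ≤ f x) (hg0 : ∀ x, 0 ≤ g x) : Integrable fun x => (√(f x) - √(g x)) ^ 2 := by
  refine (hf.add hg).mono' ?_ (ae_of_all _ fun x => ?_)
  · exact ((Real.continuous_sqrt.comp_aestronglyMeasurable hf.1).sub
      (Real.continuous_sqrt.comp_aestronglyMeasurable hg.1)).pow 2
  · rw [Real.norm_of_nonneg (sq_nonneg _)]
    exact sq_sqrt_sub_sqrt_le (hf0 x) (hg0 x)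

theorem hellinger_sq_le_integral {f g : ℝ → ℝ} (hf : Integrable f) (hg : Integrable g)
    (hf0 : ∀ x, 0 ≤ f x) (hg0 : ∀ x, 0 ≤ g x) :
    hellinger f g ^ 2 ≤ ∫ x, (√(f x) - √(g x)) ^ 2 := by
  rw [hellinger, Real.sq_sqrt (integral_nonneg fun x => sq_nonneg _)]
  exact setIntegral_le_integral (integrable_sq_sqrt_sub_sqrt hf hg hf0 hg0)
    (ae_of_all _ fun x => sq_nonneg _)

theorem hellinger_sq_le_two {f g : ℝ → ℝ} (hf : Integrable f) (hg : Integrable g)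
    (hf0 : ∀ x, 0 ≤ f x) (hg0 : ∀ x, 0 ≤ g x) (hf1 : ∫ x, f x = 1) (hg1 : ∫ x, g x = 1) :
    hellinger f g ^ 2 ≤ 2 := by
  refine (hellinger_sq_le_integral hf hg hf0 hg0).trans ?_
  calc ∫ x, (√(f x) - √(g x)) ^ 2 ≤ ∫ x, (f x + g x) :=
        integral_mono (integrable_sq_sqrt_sub_sqrt hf hg hf0 hg0) (hf.add hg)
          fun x => sq_sqrt_sub_sqrt_le (hf0 x) (hg0 x)
    _ = 2 := by rw [integral_add hf hg, hf1, hg1]; norm_num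

/-- If `U` dominates the density `g` and exceeds it by at most `n⁻²` in mass, then the affinity of
`U` and `g₀` is at most that of `g` and `g₀` plus `1 / n`. -/
theorem lintegral_sqrt_mul_le {f g g₀ : ℝ → ℝ} {n : ℝ} (hn : 0 < n) (hf : Integrable f)
    (hg : Integrable g) (hg₀ : Integrable g₀) (hgf : ∀ x, g x ≤ f x) (hgn : ∀ x, 0 ≤ g x)
    (hg₀n : ∀ x, 0 ≤ g₀ x) (hg1 : ∫ x, g x = 1) (hg₀1 : ∫ x, g₀ x = 1)
    (hf1 : ∫ x, f x ≤ 1 + 1 / n ^ 2) :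
    ∫⁻ x, (ENNReal.ofReal (f x) * ENNReal.ofReal (g₀ x)) ^ (1 / 2 : ℝ) ≤
      ENNReal.ofReal (1 - hellinger g g₀ ^ 2 / 2 + 1 / n) := by
  have hI := integrable_sq_sqrt_sub_sqrt hg hg₀ hgn hg₀n
  set R : ℝ → ℝ := fun x => ((g x + g₀ x) / 2 - (√(g x) - √(g₀ x)) ^ 2 / 2) +
    (n * (f x - g x) + g₀ x / n) / 2 with hR
  have hRi : Integrable R :=
    (((hg.add hg₀).div_const 2).sub (hI.div_const 2)).add
      ((((hf.sub hg).const_mul n).add (hg₀.div_const n)).div_const 2)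
  have hle : ∀ x, √(f x * g₀ x) ≤ R x := by
    intro x
    have hd : 0 ≤ f x - g x := sub_nonneg.2 (hgf x)
    have h1 : √(f x) ≤ √(g x) + √(f x - g x) := by
      rw [Real.sqrt_le_left (by positivity)]
      nlinarith [Real.sq_sqrt (hgn x), Real.sq_sqrt hd,
        mul_nonneg (Real.sqrt_nonneg (g x)) (Real.sqrt_nonneg (f x - g x))]
    have h2 : √(f x - g x) * √(g₀ x) ≤ (n * (f x - g x) + g₀ x / n) / 2 := by
      have h3 : 0 ≤ (n * √(f x - g x) - √(g₀ x)) ^ 2 / n := by positivity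
      have h4 : (n * √(f x - g x) - √(g₀ x)) ^ 2 / n =
          n * √(f x - g x) ^ 2 - 2 * (√(f x - g x) * √(g₀ x)) + √(g₀ x) ^ 2 / n := by
        field_simp
        ring
      rw [h4, Real.sq_sqrt hd, Real.sq_sqrt (hg₀n x)] at h3
      linarith
    have h5 : √(g x) * √(g₀ x) = (g x + g₀ x) / 2 - (√(g x) - √(g₀ x)) ^ 2 / 2 := by
      nlinarith [Real.sq_sqrt (hgn x), Real.sq_sqrt (hg₀n x)]
    rw [Real.sqrt_mul ((hgn x).trans (hgf x)), hR]
    calc √(f x) * √(g₀ x) ≤ (√(g x) + √(f x - g x)) * √(g₀ x) := by gcongr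
      _ = √(g x) * √(g₀ x) + √(f x - g x) * √(g₀ x) := by ring
      _ ≤ _ := by rw [h5]; exact add_le_add_right h2 _
  have hsqrt : ∀ x, (ENNReal.ofReal (f x) * ENNReal.ofReal (g₀ x)) ^ (1 / 2 : ℝ) =
      ENNReal.ofReal √(f x * g₀ x) := by
    intro x
    rw [← ENNReal.ofReal_mul ((hgn x).trans (hgf x)), ENNReal.ofReal_rpow_of_nonneg
      (mul_nonneg ((hgn x).trans (hgf x)) (hg₀n x)) (by norm_num), Real.sqrt_eq_rpow]
  calc ∫⁻ x, (ENNReal.ofReal (f x) * ENNReal.ofReal (g₀ x)) ^ (1 / 2 : ℝ)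
      ≤ ∫⁻ x, ENNReal.ofReal (R x) := by
        refine lintegral_mono fun x => ?_
        rw [hsqrt]
        exact ENNReal.ofReal_le_ofReal (hle x)
    _ = ENNReal.ofReal (∫ x, R x) :=
        (ofReal_integral_eq_lintegral_ofReal hRi
          (ae_of_all _ fun x => (Real.sqrt_nonneg _).trans (hle x))).symm
    _ ≤ _ := by
        refine ENNReal.ofReal_le_ofReal ?_
        have e : ∫ x, R x = ((1 + 1) / 2 - (∫ x, (√(g x) - √(g₀ x)) ^ 2) / 2) +
            (n * ((∫ x, f x) - 1) + 1 / n) / 2 := by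
          have i1 : Integrable fun x => (g x + g₀ x) / 2 := (hg.add hg₀).div_const 2
          have i2 : Integrable fun x => n * (f x - g x) := (hf.sub hg).const_mul n
          have i3 : Integrable fun x => g₀ x / n := hg₀.div_const n
          have i4 : Integrable fun x => (g x + g₀ x) / 2 - (√(g x) - √(g₀ x)) ^ 2 / 2 :=
            i1.sub (hI.div_const 2)
          have i5 : Integrable fun x => (n * (f x - g x) + g₀ x / n) / 2 := (i2.add i3).div_const 2
          simp only [hR]
          rw [integral_add i4 i5,
            integral_sub i1 (hI.div_const 2), integral_div, integral_div, integral_div,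
            integral_add hg hg₀, integral_add i2 i3, integral_const_mul, integral_sub hf hg,
            integral_div, hg1, hg₀1]
        have h1 := hellinger_sq_le_integral hg hg₀ hgn hg₀n
        have h2 : n * ((∫ x, f x) - 1) ≤ 1 / n := by
          calc n * ((∫ x, f x) - 1) ≤ n * (1 / n ^ 2) := by
                gcongr
                linarith
            _ = 1 / n := by field_simp
        rw [e]
        linarith

theorem exists_grid_point (N : ℕ) (hN : 0 < N) {y : ℝ} (hy0 : 0 ≤ y) (hy1 : y ≤ 1) :
    ∃ i : Fin (N + 1), y ≤ (i : ℝ) / N ∧ (i : ℝ) / N ≤ y + 1 / N := by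
  have hN' : (0 : ℝ) < N := by exact_mod_cast hN
  refine ⟨⟨⌈y * N⌉₊, Nat.lt_succ_of_le (Nat.ceil_le.2 ?_)⟩, ?_, ?_⟩
  · nlinarith
  · rw [le_div_iff₀ hN']
    exact Nat.le_ceil _
  · rw [div_le_iff₀ hN', add_mul, one_div_mul_cancel hN'.ne']
    exact (Nat.ceil_lt_add_one (by positivity)).le

/-- The bracketing function with all parameters on the grid of mesh `1 / N`; the factor `r ≥ 1`
compensates for rounding the support points up. -/
noncomputable def bracket {k : ℕ} (N : ℕ) (r : ℝ) {J : ℕ}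
    (i : (Fin (k + 1) → Fin (N + 1)) × (Fin J → Fin (N + 1)) × (Fin J → Fin (N + 1))) : ℝ → ℝ :=
  mixDensity (fun j => (i.1 j : ℝ) / N) (fun l => r * ((i.2.1 l : ℝ) / N))
    (fun l => (i.2.2 l : ℝ) / N)

/-- Every density with support points in `[τ, 1)` lies below a bracketing function of nearly unit
mass. Rounding a support point `θ ≥ τ` up to the grid costs a factor at most `1 + 1 / (N τ)`. -/
theorem exists_bracket {k J : ℕ} (hk : 1 ≤ k) {N : ℕ} (hN : 0 < N) {τ : ℝ} (hτ : 0 < τ)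
    {β : Fin (k + 1) → ℝ} {w θ : Fin J → ℝ} (hβ : β ∈ stdSimplex ℝ (Fin (k + 1)))
    (hw : w ∈ stdSimplex ℝ (Fin J)) (hθ : ∀ l, θ l ∈ Ico τ 1) :
    ∃ i : (Fin (k + 1) → Fin (N + 1)) × (Fin J → Fin (N + 1)) × (Fin J → Fin (N + 1)),
      (∀ x, mixDensity β w θ x ≤ bracket N (1 + 1 / (N * τ)) i x) ∧
      ∫ x, bracket N (1 + 1 / (N * τ)) i x ≤
        (1 + ((k + 1 : ℕ) : ℝ) / N) * ((1 + 1 / (N * τ)) * (1 + J / N)) := by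
  have hN' : (0 : ℝ) < N := by exact_mod_cast hN
  have hθ0 : ∀ l, 0 < θ l := fun l => hτ.trans_le (hθ l).1
  choose a ha ha' using fun j => exists_grid_point N hN (hβ.1 j) (mem_Icc_of_mem_stdSimplex hβ j).2
  choose v hv hv' using fun l => exists_grid_point N hN (hw.1 l) (mem_Icc_of_mem_stdSimplex hw l).2
  choose t ht ht' using fun l => exists_grid_point N hN (hθ0 l).le (hθ l).2.le
  set r := 1 + 1 / (N * τ) with hr
  have hr1 : 1 ≤ r := by
    rw [hr]
    have : 0 ≤ 1 / (N * τ) := by positivity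
    linarith
  have ht0 : ∀ l, 0 < (t l : ℝ) / N := fun l => (hθ0 l).trans_le (ht l)
  have hratio : ∀ l, (t l : ℝ) / N / θ l ≤ r := by
    intro l
    rw [div_le_iff₀ (hθ0 l)]
    refine (ht' l).trans ?_
    have h1 : 1 / (N : ℝ) ≤ 1 / (N * τ) * θ l := by
      rw [show (1 : ℝ) / N = 1 / (N * τ) * τ by field_simp]
      gcongr
      exact (hθ l).1
    rw [hr]
    linarith
  refine ⟨(a, v, t), fun x => ?_, ?_⟩
  · unfold bracket mixDensity
    have hb : ∀ j, 0 ≤ β j := hβ.1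
    have hw0 : ∀ l, 0 ≤ w l := hw.1
    refine add_le_add (Finset.sum_le_sum fun j _ =>
      mul_le_mul_of_nonneg_right (ha _) (psi_nonneg _ _ _))
      (mul_le_mul (ha _) (Finset.sum_le_sum fun l _ => ?_) (Finset.sum_nonneg fun l _ =>
        mul_nonneg (hw0 l) (psi_nonneg _ _ _)) (by positivity))
    have hp := psi_nonneg k x ((t l : ℝ) / N)
    calc w l * psi k x (θ l) ≤ w l * ((t l : ℝ) / N / θ l * psi k x ((t l : ℝ) / N)) :=
          mul_le_mul_of_nonneg_left (psi_le_mul_psi k x (hθ0 l) (ht l)) (hw0 l)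
      _ ≤ (v l : ℝ) / N * (r * psi k x ((t l : ℝ) / N)) := by
          refine mul_le_mul (hv l) (mul_le_mul_of_nonneg_right (hratio l) hp) ?_ (by positivity)
          exact mul_nonneg (div_nonneg (ht0 l).le (hθ0 l).le) hp
      _ = _ := by ring
  · rw [bracket, integral_mixDensity hk _ _ ht0, ← Finset.mul_sum]
    have hsa : ∑ j, (a j : ℝ) / N ≤ 1 + ((k + 1 : ℕ) : ℝ) / N := by
      refine (Finset.sum_le_sum fun j _ => ha' j).trans_eq ?_
      rw [Finset.sum_add_distrib, hβ.2]
      simp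
      ring
    have hsv : ∑ l, (v l : ℝ) / N ≤ 1 + J / N := by
      refine (Finset.sum_le_sum fun l _ => hv' l).trans_eq ?_
      rw [Finset.sum_add_distrib, hw.2]
      simp
      ring
    have hq : 1 ≤ r * (1 + J / N) := by
      have : (1 : ℝ) ≤ 1 + J / N := by
        have : (0 : ℝ) ≤ J / N := by positivity
        linarith
      nlinarith
    have hs0 : 0 ≤ ∑ j : Fin k, (a j.castSucc : ℝ) / N :=
      Finset.sum_nonneg fun j _ => by positivity
    calc (∑ j : Fin k, (a j.castSucc : ℝ) / N) + (a (Fin.last k) : ℝ) / N *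
          (r * ∑ l, (v l : ℝ) / N)
        ≤ (∑ j : Fin k, (a j.castSucc : ℝ) / N) * (r * (1 + J / N)) +
          (a (Fin.last k) : ℝ) / N * (r * (1 + J / N)) := by
          refine add_le_add (le_mul_of_one_le_right hs0 hq) ?_
          gcongr
      _ = (∑ j, (a j : ℝ) / N) * (r * (1 + J / N)) := by
          rw [← add_mul, Fin.sum_univ_castSucc (fun j => (a j : ℝ) / N)]
      _ ≤ _ := by
          gcongr

/-! ### Dirichlet distributions -/

theorem measurable_div_sum (m : ℕ) :
    Measurable fun (y : Fin m → ℝ) j => y j / ∑ i, y i := by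
  refine measurable_pi_lambda _ fun j => Measurable.div (measurable_pi_apply j) ?_
  exact Finset.measurable_sum _ fun i _ => measurable_pi_apply i

theorem isProbabilityMeasure_dirichlet {m : ℕ} {α : Fin m → ℝ} (hα : ∀ j, 0 < α j) :
    IsProbabilityMeasure (dirichlet α) := by
  have : ∀ j, IsProbabilityMeasure (gammaMeasure (α j) 1) := fun j =>
    isProbabilityMeasure_gammaMeasure (hα j) one_pos
  exact Measure.isProbabilityMeasure_map (measurable_div_sum m).aemeasurable

theorem ae_gammaMeasure_pos {α : ℝ} : ∀ᵐ y ∂(gammaMeasure α 1), 0 < y := by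
  have : gammaMeasure α 1 (Iic 0) = 0 := by
    rw [gammaMeasure, withDensity_apply _ measurableSet_Iic, ← setLIntegral_congr Iio_ae_eq_Iic]
    exact lintegral_gammaPDF_of_nonpos le_rfl
  rw [ae_iff]
  simp only [not_lt]
  exact this

theorem ae_dirichlet_mem_stdSimplex {m : ℕ} (hm : 1 ≤ m) {α : Fin m → ℝ} (hα : ∀ j, 0 < α j) :
    ∀ᵐ y ∂(dirichlet α), y ∈ stdSimplex ℝ (Fin m) := by
  have : ∀ j, IsProbabilityMeasure (gammaMeasure (α j) 1) := fun j =>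
    isProbabilityMeasure_gammaMeasure (hα j) one_pos
  have hs : MeasurableSet {y | y ∈ stdSimplex ℝ (Fin m)} :=
    (isClosed_stdSimplex ℝ (Fin m)).measurableSet
  rw [dirichlet, ae_map_iff (measurable_div_sum m).aemeasurable hs]
  have hpos : ∀ᵐ y ∂(Measure.pi fun j => gammaMeasure (α j) 1), ∀ j, 0 < y j :=
    ae_all_iff.2 fun j => (measurePreserving_eval _ j).quasiMeasurePreserving.ae
      (ae_gammaMeasure_pos (α := α j))
  have : Nonempty (Fin m) := ⟨⟨0, hm⟩⟩
  filter_upwards [hpos] with y hy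
  have hsum : 0 < ∑ i, y i := Finset.sum_pos (fun i _ => hy i) Finset.univ_nonempty
  refine ⟨fun j => (div_pos (hy j) hsum).le, ?_⟩
  rw [← Finset.sum_div, div_self hsum.ne']

/-- The constant `κ` for which the `Gamma(α, 1)` density is at least `lo κ d ^ hi` on `[d, 3]`,
for all `lo ≤ α ≤ hi` and `d ≤ 1`. -/
noncomputable def gammaConst (hi : ℝ) : ℝ := Real.exp (-3) / (3 * max 1 (Real.Gamma (hi + 1)))

theorem gammaConst_pos (hi : ℝ) : 0 < gammaConst hi := by
  unfold gammaConst
  have : (0 : ℝ) < max 1 (Real.Gamma (hi + 1)) := lt_max_of_lt_left one_pos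
  positivity

theorem le_gammaMeasure_Icc {α lo hi d u : ℝ} (hlo : 0 < lo) (h1 : lo ≤ α) (h2 : α ≤ hi)
    (hd : 0 < d) (hd1 : d ≤ 1) (hu : d ≤ u) (hu3 : u + d ≤ 3) :
    ENNReal.ofReal (lo * gammaConst hi * d ^ hi * d) ≤ gammaMeasure α 1 (Icc u (u + d)) := by
  have hα : 0 < α := hlo.trans_le h1
  have hΓ : Real.Gamma (α + 1) ≤ max 1 (Real.Gamma (hi + 1)) := by
    have := Real.convexOn_Gamma.le_max_of_mem_Icc (x := 1) (y := hi + 1) (z := α + 1)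
      (by norm_num) (show (0 : ℝ) < hi + 1 by linarith) ⟨by linarith, by linarith⟩
    simpa using this
  have hpdf : ∀ y ∈ Icc u (u + d),
      ENNReal.ofReal (lo * gammaConst hi * d ^ hi) ≤ gammaPDF α 1 y := by
    intro y hy
    have hy0 : 0 < y := hd.trans_le (hu.trans hy.1)
    have hy3 : y ≤ 3 := hy.2.trans hu3
    rw [gammaPDF_of_nonneg hy0.le]
    refine ENNReal.ofReal_le_ofReal ?_
    rw [Real.one_rpow, one_mul, Real.rpow_sub_one hy0.ne']
    have hG := Real.Gamma_pos_of_pos hα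
    have e : 1 / Real.Gamma α = α / Real.Gamma (α + 1) := by
      rw [Real.Gamma_add_one hα.ne']
      field_simp
    rw [e]
    have hK : (0 : ℝ) < max 1 (Real.Gamma (hi + 1)) := lt_max_of_lt_left one_pos
    have hG' : 0 < Real.Gamma (α + 1) := Real.Gamma_pos_of_pos (by linarith)
    calc lo * gammaConst hi * d ^ hi
        = lo / max 1 (Real.Gamma (hi + 1)) * (d ^ hi / 3) * Real.exp (-3) := by
          unfold gammaConst
          field_simp
      _ ≤ α / Real.Gamma (α + 1) * (y ^ α / y) * Real.exp (-y) := by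
          have hpow : d ^ hi ≤ y ^ α :=
            (Real.rpow_le_rpow_of_exponent_ge hd hd1 h2).trans
              (Real.rpow_le_rpow hd.le (hu.trans hy.1) hα.le)
          gcongr
  rw [gammaMeasure, withDensity_apply _ measurableSet_Icc]
  calc ENNReal.ofReal (lo * gammaConst hi * d ^ hi * d)
      = ∫⁻ _ in Icc u (u + d), ENNReal.ofReal (lo * gammaConst hi * d ^ hi) := by
        have := gammaConst_pos hi
        rw [setLIntegral_const, Real.volume_Icc, add_sub_cancel_left,
          ← ENNReal.ofReal_mul (by positivity)]
    _ ≤ ∫⁻ y in Icc u (u + d), gammaPDF α 1 y := setLIntegral_mono' measurableSet_Icc hpdf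

/-- Small ball probability of the Dirichlet distribution. Here `q - 1` is the relative error, and
`d` is the size of the windows for the independent gamma variables: if
`p_j + d ≤ Y_j ≤ p_j + 2 d`, then `∑ Y_j ≤ 1 + 2 d m ≤ q`. -/
theorem le_dirichlet {m : ℕ} {α p : Fin m → ℝ} {lo hi d q : ℝ} (hlo : 0 < lo)
    (h1 : ∀ j, lo ≤ α j) (h2 : ∀ j, α j ≤ hi) (hp : ∀ j, 0 ≤ p j) (hp1 : ∑ j, p j ≤ 1)
    (hd : 0 < d) (hd1 : d ≤ 1) (hdq : 1 + 2 * d * m ≤ q) :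
    ENNReal.ofReal (lo * gammaConst hi * d ^ hi * d) ^ m ≤
      dirichlet α {y | ∀ j, p j ≤ q * y j} := by
  have : ∀ j, IsProbabilityMeasure (gammaMeasure (α j) 1) := fun j =>
    isProbabilityMeasure_gammaMeasure (hlo.trans_le (h1 j)) one_pos
  have hpj : ∀ j, p j ≤ 1 := fun j =>
    (Finset.single_le_sum (fun i _ => hp i) (Finset.mem_univ j)).trans hp1
  have hsub : univ.pi (fun j => Icc (p j + d) (p j + d + d)) ⊆
      (fun (y : Fin m → ℝ) j => y j / ∑ i, y i) ⁻¹' {y | ∀ j, p j ≤ q * y j} := by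
    intro y hy j
    have hy' : ∀ i, p i + d ≤ y i ∧ y i ≤ p i + d + d := fun i => hy i (mem_univ i)
    have hpos : ∀ i, 0 < y i := fun i => by linarith [(hy' i).1, hp i]
    have hS : ∑ i, y i ≤ q := by
      calc ∑ i, y i ≤ ∑ i, (p i + d + d) := Finset.sum_le_sum fun i _ => (hy' i).2
        _ = ∑ i, p i + 2 * d * m := by
          simp [Finset.sum_add_distrib]
          ring
        _ ≤ q := by linarith
    have hS0 : 0 < ∑ i, y i :=
      (hpos j).trans_le (Finset.single_le_sum (fun i _ => (hpos i).le) (Finset.mem_univ j))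
    change p j ≤ q * (y j / ∑ i, y i)
    rw [← mul_div_assoc, le_div_iff₀ hS0]
    have := (hy' j).1
    calc p j * ∑ i, y i ≤ p j * q := mul_le_mul_of_nonneg_left hS (hp j)
      _ ≤ q * y j := by nlinarith
  calc ENNReal.ofReal (lo * gammaConst hi * d ^ hi * d) ^ m
      = ∏ _j : Fin m, ENNReal.ofReal (lo * gammaConst hi * d ^ hi * d) := by simp
    _ ≤ ∏ j, gammaMeasure (α j) 1 (Icc (p j + d) (p j + d + d)) :=
        Finset.prod_le_prod' fun j _ => le_gammaMeasure_Icc hlo (h1 j) (h2 j) hd hd1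
          (by linarith [hp j]) (by linarith [hpj j])
    _ = Measure.pi (fun j => gammaMeasure (α j) 1)
          (univ.pi fun j => Icc (p j + d) (p j + d + d)) := (Measure.pi_pi _ _).symm
    _ ≤ _ := measure_mono hsub
    _ ≤ _ := Measure.le_map_apply (measurable_div_sum m).aemeasurable _

/-! ### The prior -/

/-- The mixing distribution with `J` support points, with weights and support points `p`. -/
abbrev Mixing.ofPoints (J : ℕ) (p : (Fin J → ℝ) × (Fin J → ℝ)) : Mixing := ⟨J, p⟩

theorem measurable_ofPoints (J : ℕ) : Measurable (Mixing.ofPoints J) := by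
  intro s hs
  exact MeasurableSpace.measurableSet_iInf.1 hs J

theorem measurableSet_mixing {T : Set Mixing}
    (hT : ∀ J, MeasurableSet (Mixing.ofPoints J ⁻¹' T)) :
    MeasurableSet T := MeasurableSpace.measurableSet_iInf.2 hT

theorem mixingPrior_apply (n : ℕ) (c : ℝ) (ω : ∀ J : ℕ, Fin J → ℝ) (H : Measure ℝ) {T : Set Mixing}
    (hT : MeasurableSet T) :
    mixingPrior n c ω H T = ∑' J, compWeight n c J *
      ((dirichlet (ω J)).prod (Measure.pi fun _ : Fin J => H)) (Mixing.ofPoints J ⁻¹' T) := by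
  rw [mixingPrior, Measure.sum_apply _ hT]
  refine tsum_congr fun J => ?_
  rw [Measure.smul_apply, smul_eq_mul]
  exact congrArg (compWeight n c J * ·) (Measure.map_apply (measurable_ofPoints J) hT)

theorem le_mixingPrior (n : ℕ) (c : ℝ) (ω : ∀ J : ℕ, Fin J → ℝ) (H : Measure ℝ) (J : ℕ)
    (T : Set Mixing) :
    compWeight n c J * ((dirichlet (ω J)).prod (Measure.pi fun _ : Fin J => H))
      (Mixing.ofPoints J ⁻¹' T) ≤ mixingPrior n c ω H T := by
  rw [mixingPrior]
  refine le_trans ?_ ((ENNReal.le_tsum J).trans (Measure.le_sum_apply _ T))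
  rw [Measure.smul_apply, smul_eq_mul]
  gcongr
  exact Measure.le_map_apply (measurable_ofPoints J).aemeasurable _

/-- The number of support points exceeds `L` with probability `n ^ (-c L)`. -/
theorem tsum_compWeight_add {n : ℕ} (hn : 2 ≤ n) {c : ℝ} (hc : 0 < c) (L : ℕ) :
    ∑' j, compWeight n c (j + (L + 1)) = ENNReal.ofReal ((n : ℝ) ^ (-(c * L))) := by
  have hn1 : (1 : ℝ) < n := by exact_mod_cast hn
  have hn0 : (0 : ℝ) < n := by linarith
  set r : ℝ := (n : ℝ) ^ (-c) with hr
  have hr0 : 0 < r := Real.rpow_pos_of_pos hn0 _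
  have hr1 : r < 1 := Real.rpow_lt_one_of_one_lt_of_neg hn1 (by linarith)
  have hpow : ∀ m : ℕ, (n : ℝ) ^ (-(c * m)) = r ^ m := by
    intro m
    rw [hr, ← Real.rpow_natCast, ← Real.rpow_mul hn0.le]
    congr 1
    ring
  have hinv : (n : ℝ) ^ c * r = 1 := by
    rw [hr, ← Real.rpow_add hn0]
    simp
  have hq : ∀ j, compWeight n c (j + (L + 1)) =
      (1 - ENNReal.ofReal r) * ENNReal.ofReal r ^ L * ENNReal.ofReal r ^ j := by
    intro j
    rw [compWeight, if_neg (by omega), hpow, ← ENNReal.ofReal_one, ← ENNReal.ofReal_sub _ hr0.le,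
      ← ENNReal.ofReal_pow hr0.le, ← ENNReal.ofReal_pow hr0.le, ← ENNReal.ofReal_mul (by linarith),
      ← ENNReal.ofReal_mul (by nlinarith [pow_pos hr0 L])]
    congr 1
    calc ((n : ℝ) ^ c - 1) * r ^ (j + (L + 1)) = ((n : ℝ) ^ c * r - r) * r ^ L * r ^ j := by ring
      _ = _ := by rw [hinv]
  simp_rw [hq]
  rw [ENNReal.tsum_mul_left, ENNReal.tsum_geometric, hpow, ENNReal.ofReal_pow hr0.le, mul_comm,
    ← mul_assoc, ENNReal.inv_mul_cancel, one_mul]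
  · rw [← ENNReal.ofReal_one, ← ENNReal.ofReal_sub _ hr0.le]
    simpa using hr1
  · exact ENNReal.sub_ne_top ENNReal.one_ne_top

theorem tsum_compWeight {n : ℕ} (hn : 2 ≤ n) {c : ℝ} (hc : 0 < c) :
    ∑' J, compWeight n c J = 1 := by
  have h := tsum_compWeight_add hn hc 0
  rw [tsum_eq_zero_add' ENNReal.summable]
  simpa [compWeight] using h

theorem isProbabilityMeasure_mixingPrior {n : ℕ} (hn : 2 ≤ n) {c : ℝ} (hc : 0 < c)
    {ω : ∀ J : ℕ, Fin J → ℝ} (hω : ∀ J j, 0 < ω J j) (H : Measure ℝ) [IsProbabilityMeasure H] :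
    IsProbabilityMeasure (mixingPrior n c ω H) := by
  have := fun J => isProbabilityMeasure_dirichlet (hω J)
  constructor
  rw [mixingPrior_apply _ _ _ _ MeasurableSet.univ]
  simp [tsum_compWeight hn hc]

theorem isProbabilityMeasure_prior {k n : ℕ} (hn : 2 ≤ n) {c : ℝ} (hc : 0 < c)
    {a : Fin (k + 1) → ℝ} (ha : ∀ j, 0 < a j)
    {ω : ∀ J : ℕ, Fin J → ℝ} (hω : ∀ J j, 0 < ω J j) (H : Measure ℝ) [IsProbabilityMeasure H] :
    IsProbabilityMeasure (prior n c a ω H) := by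
  have := isProbabilityMeasure_dirichlet ha
  have := isProbabilityMeasure_mixingPrior hn hc hω H
  unfold prior
  infer_instance

/-- The parameters with probability vectors `β` and `w`, at most `L` support points, and all
support points in `S`; `L = ⊤` puts no restriction on their number. -/
def sieve (k : ℕ) (L : ℕ∞) (S : Set ℝ) : Set (Param k) :=
  {ξ | ξ.1 ∈ stdSimplex ℝ (Fin (k + 1)) ∧ (ξ.2.1 : ℕ∞) ≤ L ∧
    ξ.2.2.1 ∈ stdSimplex ℝ (Fin ξ.2.1) ∧ ∀ l, ξ.2.2.2 l ∈ S}

/-- A union bound over the support points, given their number `J`. -/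
theorem prior_compl_sieve_le {k n : ℕ} {c : ℝ} {a : Fin (k + 1) → ℝ} (ha : ∀ j, 0 < a j)
    {ω : ∀ J : ℕ, Fin J → ℝ} (hω : ∀ J j, 0 < ω J j) (H : Measure ℝ) [IsProbabilityMeasure H]
    (L : ℕ∞) {S : Set ℝ} (hS : MeasurableSet S) :
    prior n c a ω H (sieve k L S)ᶜ ≤
      ∑' J : ℕ, compWeight n c J * (if (J : ℕ∞) ≤ L then J * H Sᶜ else 1) := by
  have := isProbabilityMeasure_dirichlet ha
  have := fun J => isProbabilityMeasure_dirichlet (hω J)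
  have : SFinite (mixingPrior n c ω H) := by
    unfold mixingPrior
    have : ∀ J, SFinite (compWeight n c J • ((dirichlet (ω J)).prod
      (Measure.pi fun _ : Fin J => H)).map (Mixing.ofPoints J)) := fun J => inferInstance
    infer_instance
  set T : Set Mixing := {s | (s.1 : ℕ∞) ≤ L ∧ s.2.1 ∈ stdSimplex ℝ (Fin s.1) ∧ ∀ l, s.2.2 l ∈ S}
    with hT
  have hTm : MeasurableSet T := measurableSet_mixing fun J => by
    have : (Mixing.ofPoints J ⁻¹' T) =
        {_z | (J : ℕ∞) ≤ L} ∩ stdSimplex ℝ (Fin J) ×ˢ univ.pi fun _ => S := by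
      ext z
      simp [hT]
    rw [this]
    exact (MeasurableSet.const _).inter ((isClosed_stdSimplex ℝ (Fin J)).measurableSet.prod
      (MeasurableSet.univ_pi fun _ => hS))
  have hsub : (sieve k L S)ᶜ ⊆ (stdSimplex ℝ (Fin (k + 1)))ᶜ ×ˢ univ ∪ univ ×ˢ Tᶜ := by
    intro ξ hξ
    by_contra h
    simp only [mem_union, mem_prod, mem_compl_iff, mem_univ, and_true, true_and, not_or,
      not_not] at h
    exact hξ ⟨h.1, h.2⟩
  have h0 : dirichlet a (stdSimplex ℝ (Fin (k + 1)))ᶜ = 0 :=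
    ae_dirichlet_mem_stdSimplex (by omega) ha
  calc prior n c a ω H (sieve k L S)ᶜ
      ≤ prior n c a ω H ((stdSimplex ℝ (Fin (k + 1)))ᶜ ×ˢ univ) +
        prior n c a ω H (univ ×ˢ Tᶜ) := (measure_mono hsub).trans (measure_union_le _ _)
    _ = mixingPrior n c ω H Tᶜ := by
        rw [prior, Measure.prod_prod, Measure.prod_prod, h0, zero_mul, zero_add,
          measure_univ (μ := dirichlet a), one_mul]
    _ ≤ _ := by
        rw [mixingPrior_apply _ _ _ _ hTm.compl]
        refine ENNReal.tsum_le_tsum fun J => ?_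
        -- `J = 0` has weight zero; there the simplex is empty
        rcases Nat.eq_zero_or_pos J with rfl | hJ
        · simp [compWeight]
        gcongr
        split_ifs with hJL
        · have hsubJ : (Mixing.ofPoints J ⁻¹' Tᶜ) ⊆
              (stdSimplex ℝ (Fin J))ᶜ ×ˢ univ ∪
                ⋃ l : Fin J, univ ×ˢ (Function.eval l ⁻¹' Sᶜ) := by
            intro z hz
            by_contra h
            simp only [mem_union, mem_prod, mem_compl_iff, mem_univ, and_true, true_and, not_or,
              not_not, mem_iUnion, not_exists, mem_preimage, Function.eval] at h
            exact hz ⟨hJL, h.1, h.2⟩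
          have h0J : dirichlet (ω J) (stdSimplex ℝ (Fin J))ᶜ = 0 :=
            ae_dirichlet_mem_stdSimplex hJ (hω J)
          refine (measure_mono hsubJ).trans ((measure_union_le _ _).trans ?_)
          rw [Measure.prod_prod, h0J, zero_mul, zero_add]
          refine (measure_iUnion_fintype_le _ _).trans ?_
          simp_rw [Measure.prod_prod, measure_univ, one_mul]
          have : ∀ l : Fin J, Measure.pi (fun _ : Fin J => H) (Function.eval l ⁻¹' Sᶜ) = H Sᶜ :=
            fun l => (measurePreserving_eval (fun _ : Fin J => H) l).measure_preimage
              hS.compl.nullMeasurableSet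
          rw [Finset.sum_congr rfl fun l _ => this l]
          simp
        · exact prob_le_one

theorem prior_compl_sieve_top {k n : ℕ} {c : ℝ} {a : Fin (k + 1) → ℝ} (ha : ∀ j, 0 < a j)
    {ω : ∀ J : ℕ, Fin J → ℝ} (hω : ∀ J j, 0 < ω J j) (H : Measure ℝ) [IsProbabilityMeasure H]
    (hH : H (Ioo 0 1)ᶜ = 0) : prior n c a ω H (sieve k ⊤ (Ioo 0 1))ᶜ = 0 := by
  refine le_antisymm ((prior_compl_sieve_le ha hω H ⊤ measurableSet_Ioo).trans ?_) zero_le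
  simp [hH]

theorem prior_compl_sieve_le_add {k n : ℕ} (hn : 2 ≤ n) {c : ℝ} (hc : 0 < c)
    {a : Fin (k + 1) → ℝ} (ha : ∀ j, 0 < a j)
    {ω : ∀ J : ℕ, Fin J → ℝ} (hω : ∀ J j, 0 < ω J j) (H : Measure ℝ) [IsProbabilityMeasure H]
    (L : ℕ) {S : Set ℝ} (hS : MeasurableSet S) :
    prior n c a ω H (sieve k L S)ᶜ ≤ L * H Sᶜ + ENNReal.ofReal ((n : ℝ) ^ (-(c * L))) := by
  refine (prior_compl_sieve_le ha hω H L hS).trans ?_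
  calc ∑' J : ℕ, compWeight n c J * (if (J : ℕ∞) ≤ L then J * H Sᶜ else 1)
      ≤ ∑' J : ℕ, (compWeight n c J * (L * H Sᶜ) + if J ≤ L then 0 else compWeight n c J) := by
        refine ENNReal.tsum_le_tsum fun J => ?_
        by_cases h : J ≤ L
        · have h' : (J : ℕ∞) ≤ L := by exact_mod_cast h
          have h'' : (J : ℝ≥0∞) ≤ L := by exact_mod_cast h
          rw [if_pos h', if_pos h, add_zero]
          gcongr
        · have h' : ¬ (J : ℕ∞) ≤ L := by exact_mod_cast h
          rw [if_neg h', if_neg h, mul_one]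
          exact le_add_self
    _ = L * H Sᶜ + ∑' J : ℕ, if J ≤ L then 0 else compWeight n c J := by
        rw [ENNReal.tsum_add, ENNReal.tsum_mul_right, tsum_compWeight hn hc, one_mul]
    _ = L * H Sᶜ + ∑' j : ℕ, compWeight n c (j + (L + 1)) := by
        rw [← ENNReal.summable.sum_add_tsum_nat_add' (k := L + 1)]
        rw [Finset.sum_eq_zero, zero_add]
        · congr 1
          refine tsum_congr fun j => if_neg (by omega)
        · intro i hi
          rw [Finset.mem_range] at hi
          exact if_pos (by omega)
    _ = _ := by rw [tsum_compWeight_add hn hc]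

/-- The mass that `H` puts near zero. -/
theorem measure_compl_Ico_le {H : Measure ℝ} {p : ℝ → ℝ} {τ C t : ℝ} (hτ1 : τ ≤ 1)
    (hC : 0 ≤ C) (ht : 0 ≤ t)
    (hH : H = (volume.restrict (Ioo (0 : ℝ) 1)).withDensity fun θ => ENNReal.ofReal (p θ))
    (hp : ∀ θ, 0 < θ → θ < τ → p θ ≤ C * Real.exp (-t / θ)) :
    H (Ico τ 1)ᶜ ≤ ENNReal.ofReal (C * Real.exp (-t / τ)) := by
  have hm := (measurableSet_Ico (a := τ) (b := (1 : ℝ))).compl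
  have hset : (Ico τ 1)ᶜ ∩ Ioo 0 1 = Ioo 0 τ := by
    ext θ
    simp only [mem_inter_iff, mem_compl_iff, mem_Ico, mem_Ioo, not_and, not_lt]
    constructor
    · rintro ⟨h1, h2, h3⟩
      refine ⟨h2, ?_⟩
      by_contra h
      linarith [h1 (not_lt.1 h)]
    · rintro ⟨h1, h2⟩
      exact ⟨fun h => by linarith, h1, by linarith⟩
  rw [hH, withDensity_apply _ hm, Measure.restrict_restrict hm, hset]
  calc ∫⁻ θ in Ioo 0 τ, ENNReal.ofReal (p θ)
      ≤ ∫⁻ _ in Ioo 0 τ, ENNReal.ofReal (C * Real.exp (-t / τ)) := by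
        refine setLIntegral_mono' measurableSet_Ioo fun θ hθ => ENNReal.ofReal_le_ofReal ?_
        refine (hp θ hθ.1 hθ.2).trans ?_
        rw [neg_div, neg_div]
        have : t / τ ≤ t / θ := div_le_div_of_nonneg_left ht hθ.1 hθ.2.le
        gcongr
    _ ≤ _ := by
        rw [setLIntegral_const, Real.volume_Ioo, sub_zero]
        exact mul_le_of_le_one_right' (by simpa using hτ1)

/-! ### Parameters whose density dominates the true density -/

/-- A box of parameters on which the density is at least `q⁻³` times the true density.
A support point `θ₀` is replaced by points of `(θ₀, q θ₀)`. If this interval is not contained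
in `(0, 1)`, then `ψ_k(·, θ₀) ≤ q ψ_k(·, 1)`, and the weight of `θ₀` is moved to the last
polynomial coefficient, the one of `ψ_k(·, 1)`. -/
theorem exists_dominating {k J : ℕ} (hk : 1 ≤ k) {q τ : ℝ} (hq : 1 < q) (hq2 : q ≤ 2)
    (hτ : 0 < τ) (hτ2 : τ ≤ 1 / 2) {β₀ : Fin (k + 1) → ℝ} {w₀ θ₀ : Fin J → ℝ}
    (hβ₀ : β₀ ∈ stdSimplex ℝ (Fin (k + 1))) (hw₀ : w₀ ∈ stdSimplex ℝ (Fin J))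
    (hθ₀ : ∀ l, θ₀ l ∈ Ico τ 1) :
    ∃ (β' : Fin (k + 1) → ℝ) (w' u v : Fin J → ℝ), (∀ j, 0 ≤ β' j) ∧ ∑ j, β' j ≤ 1 ∧
      (∀ l, 0 ≤ w' l) ∧ ∑ l, w' l ≤ 1 ∧
      (∀ l, τ ≤ u l ∧ τ * (q - 1) ≤ v l - u l ∧ v l ≤ 1) ∧
      ∀ (β : Fin (k + 1) → ℝ) (w θ : Fin J → ℝ), (∀ j, β' j ≤ q * β j) → (∀ l, w' l ≤ q * w l) →
        (∀ l, θ l ∈ Ioo (u l) (v l)) →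
        ∀ x, mixDensity β₀ w₀ θ₀ x ≤ q ^ 3 * mixDensity β w θ x := by
  classical
  have hb0 : ∀ j, 0 ≤ β₀ j := hβ₀.1
  have hw0 : ∀ l, 0 ≤ w₀ l := hw₀.1
  have hq0 : 0 < q := by linarith
  -- the support points too close to `1`, and their total weight
  set F : Finset (Fin J) := Finset.univ.filter fun l => 1 < θ₀ l * q with hF
  set m : ℝ := ∑ l ∈ F, w₀ l with hm
  have hm0 : 0 ≤ m := Finset.sum_nonneg fun l _ => hw0 l
  have hcompl : ∑ l ∈ Fᶜ, w₀ l = 1 - m := by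
    rw [← hw₀.2, hm, ← Finset.sum_add_sum_compl F w₀]
    ring
  have hm1 : 0 ≤ 1 - m := hcompl ▸ Finset.sum_nonneg fun l _ => hw0 l
  set j₁ : Fin k := ⟨k - 1, by omega⟩ with hj₁
  set b : Fin k → ℝ := fun j => β₀ j.castSucc + if j = j₁ then β₀ (Fin.last k) * m else 0 with hb
  set w' : Fin J → ℝ := fun l => if l ∈ F then 0 else w₀ l / (1 - m) with hw'
  have hbnn : ∀ j, 0 ≤ b j := by
    intro j
    have := mul_nonneg (hb0 (Fin.last k)) hm0
    have := hb0 j.castSucc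
    simp only [hb]
    split_ifs <;> linarith
  refine ⟨Fin.snoc b (β₀ (Fin.last k) * (1 - m)), w',
    fun l => if l ∈ F then τ else θ₀ l, fun l => if l ∈ F then 1 else θ₀ l * q,
    ?_, ?_, ?_, ?_, ?_, ?_⟩
  · intro j
    refine Fin.lastCases ?_ (fun j => ?_) j
    · rw [Fin.snoc_last]
      exact mul_nonneg (hb0 _) hm1
    · rw [Fin.snoc_castSucc]
      exact hbnn j
  · rw [Fin.sum_univ_castSucc]
    simp only [Fin.snoc_castSucc, Fin.snoc_last]
    have h1 := hβ₀.2
    rw [Fin.sum_univ_castSucc] at h1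
    rw [hb, Finset.sum_add_distrib, Finset.sum_ite_eq' Finset.univ j₁]
    simp only [Finset.mem_univ, if_true]
    linarith
  · intro l
    simp only [hw']
    split_ifs
    · exact le_rfl
    · exact div_nonneg (hw0 l) hm1
  · rw [hw', ← Finset.sum_add_sum_compl F]
    rw [Finset.sum_eq_zero fun l hl => if_pos hl, zero_add,
      Finset.sum_congr rfl fun l hl => if_neg (Finset.mem_compl.1 hl), ← Finset.sum_div, hcompl]
    exact div_self_le_one _
  · intro l
    have h1 := (hθ₀ l).1
    by_cases hl : l ∈ F
    · simp only [if_pos hl]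
      exact ⟨le_rfl, by nlinarith, le_rfl⟩
    · simp only [if_neg hl]
      refine ⟨h1, by nlinarith, ?_⟩
      by_contra h
      exact hl (Finset.mem_filter.2 ⟨Finset.mem_univ l, not_le.1 h⟩)
  · intro β w θ hβ hw hθ x
    have hβnn : ∀ j : Fin k, b j ≤ q * β j.castSucc := fun j => by
      have := hβ j.castSucc
      rwa [Fin.snoc_castSucc] at this
    have hβl : β₀ (Fin.last k) * (1 - m) ≤ q * β (Fin.last k) := by
      have := hβ (Fin.last k)
      rwa [Fin.snoc_last] at this
    have hψ := fun k θ => psi_nonneg k x θ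
    have hw'0 : ∀ l, 0 ≤ w' l := by
      intro l
      simp only [hw']
      split_ifs
      · exact le_rfl
      · exact div_nonneg (hw0 l) hm1
    have hwq : ∀ l, 0 ≤ q * w l := fun l => (hw'0 l).trans (hw l)
    have hsplit : ∑ l, w₀ l * psi k x (θ₀ l) =
        ∑ l ∈ F, w₀ l * psi k x (θ₀ l) + ∑ l ∈ Fᶜ, w₀ l * psi k x (θ₀ l) :=
      (Finset.sum_add_sum_compl F _).symm
    have hnear : ∑ l ∈ F, w₀ l * psi k x (θ₀ l) ≤ m * (q * psi k x 1) := by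
      rw [hm, Finset.sum_mul]
      refine Finset.sum_le_sum fun l hl => mul_le_mul_of_nonneg_left ?_ (hw0 l)
      have hθl : 0 < θ₀ l := hτ.trans_le (hθ₀ l).1
      refine (psi_le_mul_psi k x hθl (hθ₀ l).2.le).trans
        (mul_le_mul_of_nonneg_right ?_ (hψ _ _))
      rw [div_le_iff₀ hθl, mul_comm]
      exact (Finset.mem_filter.1 hl).2.le
    -- if all weight is moved, then `1 - m = 0`, and the remaining weights vanish
    have hfar : β₀ (Fin.last k) * ∑ l ∈ Fᶜ, w₀ l * psi k x (θ₀ l) ≤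
        β₀ (Fin.last k) * (1 - m) * ∑ l, q * w l * (q * psi k x (θ l)) := by
      rw [mul_assoc]
      refine mul_le_mul_of_nonneg_left ?_ (hb0 _)
      rw [Finset.mul_sum]
      refine (Finset.sum_le_sum fun l hl => ?_).trans (Finset.sum_le_sum_of_subset_of_nonneg
        (Finset.subset_univ Fᶜ) fun l _ _ =>
          mul_nonneg hm1 (mul_nonneg (hwq l) (mul_nonneg hq0.le (hψ _ _))))
      have hlF := Finset.mem_compl.1 hl
      have hwl : w₀ l = (1 - m) * w' l := by
        simp only [hw', if_neg hlF]
        by_cases h : 1 - m = 0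
        · have := Finset.single_le_sum (fun i _ => hw0 i) hl
          rw [hcompl, h] at this
          rw [h, zero_mul]
          exact le_antisymm this (hw0 l)
        · rw [mul_div_cancel₀ _ h]
      have hθl : 0 < θ₀ l := hτ.trans_le (hθ₀ l).1
      have hθ' := hθ l
      simp only [if_neg hlF] at hθ'
      have hp : psi k x (θ₀ l) ≤ q * psi k x (θ l) := by
        refine (psi_le_mul_psi k x hθl hθ'.1.le).trans (mul_le_mul_of_nonneg_right ?_ (hψ _ _))
        rw [div_le_iff₀ hθl, mul_comm]
        exact hθ'.2.le
      rw [hwl, mul_assoc]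
      exact mul_le_mul_of_nonneg_left
        (mul_le_mul (hw l) hp (hψ _ _) (hwq l)) hm1
    have hpoly : ∑ j : Fin k, b j * psi (j + 1) x 1 =
        ∑ j : Fin k, β₀ j.castSucc * psi (j + 1) x 1 + β₀ (Fin.last k) * m * psi k x 1 := by
      simp only [hb, add_mul, ite_mul, zero_mul, Finset.sum_add_distrib]
      rw [Finset.sum_ite_eq' Finset.univ j₁]
      simp only [Finset.mem_univ, if_true, hj₁]
      rw [Nat.sub_add_cancel hk]
    have hA : 0 ≤ ∑ j : Fin k, β₀ j.castSucc * psi (j + 1) x 1 :=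
      Finset.sum_nonneg fun j _ => mul_nonneg (hb0 _) (hψ _ _)
    have hS : 0 ≤ ∑ l, q * w l * (q * psi k x (θ l)) :=
      Finset.sum_nonneg fun l _ => mul_nonneg (hwq l) (mul_nonneg hq0.le (hψ _ _))
    have hB0 : 0 ≤ ∑ j : Fin k, b j * psi (j + 1) x 1 :=
      Finset.sum_nonneg fun j _ => mul_nonneg (hbnn j) (hψ _ _)
    have hB : ∑ j : Fin k, b j * psi (j + 1) x 1 ≤
        q * ∑ j : Fin k, β j.castSucc * psi (j + 1) x 1 := by
      rw [Finset.mul_sum]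
      refine Finset.sum_le_sum fun j _ => ?_
      rw [← mul_assoc]
      exact mul_le_mul_of_nonneg_right (hβnn j) (hψ _ _)
    calc mixDensity β₀ w₀ θ₀ x
        = ∑ j : Fin k, β₀ j.castSucc * psi (j + 1) x 1 +
          (β₀ (Fin.last k) * ∑ l ∈ F, w₀ l * psi k x (θ₀ l) +
            β₀ (Fin.last k) * ∑ l ∈ Fᶜ, w₀ l * psi k x (θ₀ l)) := by
          rw [mixDensity, hsplit, mul_add]
      _ ≤ q * (∑ j : Fin k, β₀ j.castSucc * psi (j + 1) x 1) +
          (β₀ (Fin.last k) * (m * (q * psi k x 1)) +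
            β₀ (Fin.last k) * (1 - m) * ∑ l, q * w l * (q * psi k x (θ l))) := by
          refine add_le_add (le_mul_of_one_le_left hA hq.le) (add_le_add ?_ hfar)
          exact mul_le_mul_of_nonneg_left hnear (hb0 _)
      _ = q * (∑ j : Fin k, b j * psi (j + 1) x 1) +
            β₀ (Fin.last k) * (1 - m) * ∑ l, q * w l * (q * psi k x (θ l)) := by
          rw [hpoly]
          ring
      _ ≤ q ^ 2 * (∑ j : Fin k, b j * psi (j + 1) x 1) +
            q * β (Fin.last k) * ∑ l, q * w l * (q * psi k x (θ l)) := by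
          refine add_le_add (mul_le_mul_of_nonneg_right ?_ hB0)
            (mul_le_mul_of_nonneg_right hβl hS)
          nlinarith
      _ ≤ q ^ 2 * (q * ∑ j : Fin k, β j.castSucc * psi (j + 1) x 1) +
            q * β (Fin.last k) * ∑ l, q * w l * (q * psi k x (θ l)) := by
          gcongr
      _ = q ^ 3 * mixDensity β w θ x := by
          rw [mixDensity]
          have : ∑ l, q * w l * (q * psi k x (θ l)) = q ^ 2 * ∑ l, w l * psi k x (θ l) := by
            rw [Finset.mul_sum]
            exact Finset.sum_congr rfl fun l _ => by ring
          rw [this]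
          ring

/-- A lower bound for the prior probability of the parameters whose density dominates the true
density up to the factor `q ^ 3`. -/
theorem le_prior_dominating {k J n : ℕ} (hk : 1 ≤ k) {q τ : ℝ} (hq : 1 < q) (hq2 : q ≤ 2)
    (hτ : 0 < τ) (hτ2 : τ ≤ 1 / 2) {β₀ : Fin (k + 1) → ℝ} {w₀ θ₀ : Fin J → ℝ}
    (hβ₀ : β₀ ∈ stdSimplex ℝ (Fin (k + 1))) (hw₀ : w₀ ∈ stdSimplex ℝ (Fin J))
    (hθ₀ : ∀ l, θ₀ l ∈ Ico τ 1) {c : ℝ} {a : Fin (k + 1) → ℝ} {ω : ∀ J : ℕ, Fin J → ℝ}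
    {H : Measure ℝ} [IsProbabilityMeasure H] {a_lo a_hi ω_lo ω_hi d t C : ℝ} (ha_lo : 0 < a_lo)
    (ha : ∀ j, a_lo ≤ a j ∧ a j ≤ a_hi) (hω_pos : ∀ J j, 0 < ω J j) (hω_lo : 0 < ω_lo)
    (hω : ∀ j, ω_lo ≤ ω J j ∧ ω J j ≤ ω_hi)
    (hd : 0 < d) (hd1 : d ≤ 1) (hdk : 1 + 2 * d * (k + 1 : ℕ) ≤ q) (hdJ : 1 + 2 * d * J ≤ q)
    (ht : 0 < t) (hC : 0 < C)
    (hH : ∀ u v : ℝ, τ ≤ u → u < v → v ≤ 1 → ENNReal.ofReal (C * (v - u) ^ t) ≤ H (Ioo u v)) :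
    ENNReal.ofReal (a_lo * gammaConst a_hi * d ^ a_hi * d) ^ (k + 1) * (compWeight n c J *
      (ENNReal.ofReal (ω_lo * gammaConst ω_hi * d ^ ω_hi * d) ^ J *
        ENNReal.ofReal (C * (τ * (q - 1)) ^ t) ^ J)) ≤
    prior n c a ω H {ξ | ∀ x, mixDensity β₀ w₀ θ₀ x ≤ q ^ 3 * ξ.density x} := by
  have := isProbabilityMeasure_dirichlet fun j => ha_lo.trans_le (ha j).1
  have := fun J => isProbabilityMeasure_dirichlet (hω_pos J)
  have : SFinite (mixingPrior n c ω H) := by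
    unfold mixingPrior
    infer_instance
  obtain ⟨β', w', u, v, hβ', hβ'1, hw', hw'1, huv, hdom⟩ :=
    exists_dominating hk hq hq2 hτ hτ2 hβ₀ hw₀ hθ₀
  set Sβ : Set (Fin (k + 1) → ℝ) := {β | ∀ j, β' j ≤ q * β j} with hSβ
  set Sw : Set (Fin J → ℝ) := {w | ∀ l, w' l ≤ q * w l} with hSw
  set Sθ : Set (Fin J → ℝ) := univ.pi fun l => Ioo (u l) (v l) with hSθ
  have hsub : Sβ ×ˢ (Mixing.ofPoints J '' (Sw ×ˢ Sθ)) ⊆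
      {ξ : Param k | ∀ x, mixDensity β₀ w₀ θ₀ x ≤ q ^ 3 * ξ.density x} := by
    rintro ⟨β, s⟩ ⟨hβ, ⟨⟨w, θ⟩, ⟨hw, hθ⟩, rfl⟩⟩ x
    exact hdom β w θ hβ hw (fun l => hθ l (mem_univ l)) x
  refine le_trans ?_ (measure_mono hsub)
  rw [prior, Measure.prod_prod]
  refine mul_le_mul' (le_dirichlet ha_lo (fun j => (ha j).1) (fun j => (ha j).2) hβ' hβ'1 hd hd1 hdk)
    (le_trans ?_ (le_mixingPrior n c ω H J _))
  refine mul_le_mul_right ?_ _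
  refine le_trans ?_ (measure_mono (subset_preimage_image _ _))
  rw [Measure.prod_prod, hSθ, Measure.pi_pi]
  refine mul_le_mul' (le_dirichlet hω_lo (fun j => (hω j).1) (fun j => (hω j).2) hw' hw'1 hd hd1 hdJ)
    ?_
  calc ENNReal.ofReal (C * (τ * (q - 1)) ^ t) ^ J
      = ∏ _l : Fin J, ENNReal.ofReal (C * (τ * (q - 1)) ^ t) := by simp
    _ ≤ _ := Finset.prod_le_prod' fun l _ => by
        obtain ⟨h1, h2, h3⟩ := huv l
        have hpos : 0 < τ * (q - 1) := mul_pos hτ (by linarith)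
        refine le_trans (ENNReal.ofReal_le_ofReal ?_) (hH _ _ h1 (by linarith) h3)
        gcongr

/-- Where the density dominates `g₀` up to a factor, so does the likelihood; this bounds the
marginal likelihood from below without any probability computation under `g₀`. -/
theorem mul_prod_le_lintegral {Ξ : Type*} [MeasurableSpace Ξ] {P : Measure Ξ} {p : Ξ → ℝ → ℝ}
    (hp : Measurable (Function.uncurry p)) {g₀ : ℝ → ℝ} {r : ℝ} (hr : 0 < r) {n : ℕ}
    (x : Fin n → ℝ) :
    ENNReal.ofReal (r⁻¹ ^ n) * P {ξ | ∀ x, g₀ x ≤ r * p ξ x} * ∏ i, ENNReal.ofReal (g₀ (x i)) ≤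
      ∫⁻ ξ, ∏ i, ENNReal.ofReal (p ξ (x i)) ∂P := by
  have hm : Measurable fun ξ => ∏ i, ENNReal.ofReal (p ξ (x i)) :=
    Finset.measurable_prod _ fun i _ => (hp.comp measurable_prodMk_right).ennreal_ofReal
  refine le_trans (le_of_eq ?_) (le_trans (mul_le_mul_right
    (measure_mono (s := {ξ | ∀ x, g₀ x ≤ r * p ξ x}) ?_) _)
    (mul_meas_ge_le_lintegral hm
      (ENNReal.ofReal (r⁻¹ ^ n) * ∏ i, ENNReal.ofReal (g₀ (x i)))))
  · ring
  · intro ξ hξ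
    have e : ENNReal.ofReal (r⁻¹ ^ n) = ∏ _i : Fin n, ENNReal.ofReal r⁻¹ := by
      rw [ENNReal.ofReal_pow (by positivity)]
      simp
    change ENNReal.ofReal (r⁻¹ ^ n) * ∏ i, ENNReal.ofReal (g₀ (x i)) ≤ _
    rw [e, ← Finset.prod_mul_distrib]
    refine Finset.prod_le_prod' fun i _ => ?_
    rw [← ENNReal.ofReal_mul (by positivity)]
    refine ENNReal.ofReal_le_ofReal ?_
    rw [inv_mul_le_iff₀ hr]
    exact hξ (x i)

/-! ### Bounds for a fixed sample size -/

/-- The prior mass of the parameters that nearly dominate the truth is at least `n ^ (-C m)`,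
`m = max k J`. The windows for the gamma variables have size `n⁻³`, and the support points have
windows of size at least `n⁻³`. -/
theorem exp_le_prior_dominating {k J n : ℕ} (hk : 1 ≤ k) (hJ : 1 ≤ J) (hn : 4 ≤ n) (hkn : k ≤ n)
    (hJn : J ≤ n) {β₀ : Fin (k + 1) → ℝ} {w₀ θ₀ : Fin J → ℝ}
    (hβ₀ : β₀ ∈ stdSimplex ℝ (Fin (k + 1))) (hw₀ : w₀ ∈ stdSimplex ℝ (Fin J))
    (hθ₀ : ∀ l, θ₀ l ∈ Ico ((n : ℝ) ^ 2)⁻¹ 1) {c : ℝ} (hc : 0 < c)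
    {a : Fin (k + 1) → ℝ} {ω : ∀ J : ℕ, Fin J → ℝ}
    {H : Measure ℝ} [IsProbabilityMeasure H] {a_lo a_hi ω_lo ω_hi b t C : ℝ} (ha_lo : 0 < a_lo)
    (ha : ∀ j, a_lo ≤ a j ∧ a j ≤ a_hi) (hω_pos : ∀ J j, 0 < ω J j) (hω_lo : 0 < ω_lo)
    (hω : ∀ j, ω_lo * (J : ℝ) ^ (-b) ≤ ω J j ∧ ω J j ≤ ω_hi) (ht : 0 < t) (hC : 0 < C)
    (hH : ∀ u v : ℝ, ((n : ℝ) ^ 2)⁻¹ ≤ u → u < v → v ≤ 1 →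
      ENNReal.ofReal (C * (v - u) ^ t) ≤ H (Ioo u v))
    (h_a : Real.exp (-Real.log n) ≤ a_lo * gammaConst a_hi)
    (h_ω : Real.exp (-Real.log n) ≤ ω_lo * gammaConst ω_hi)
    (h_C : Real.exp (-Real.log n) ≤ C) (h_c : 2 ≤ (n : ℝ) ^ c) (h_log : 1 ≤ Real.log n) :
    ENNReal.ofReal (Real.exp (-((2 * (1 + 3 * (a_hi + 1)) + c + (1 + |b| + 3 * (ω_hi + 1)) +
        (1 + 3 * t) + 3) * (((max k J : ℕ) : ℝ) * Real.log n)))) ≤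
      ENNReal.ofReal ((((1 + 1 / (n : ℝ)) ^ 3)⁻¹) ^ n) * prior n c a ω H
        {ξ | ∀ x, mixDensity β₀ w₀ θ₀ x ≤ (1 + 1 / (n : ℝ)) ^ 3 * ξ.density x} := by
  set ℓ := Real.log n with hℓ
  have hn4 : (4 : ℝ) ≤ n := by exact_mod_cast hn
  have hn0 : (0 : ℝ) < n := by linarith
  have hexp : ∀ s : ℝ, (n : ℝ) ^ s = Real.exp (s * ℓ) := fun s => by
    rw [Real.rpow_def_of_pos hn0, mul_comm]
  set d : ℝ := Real.exp (-(3 * ℓ)) with hd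
  have hd' : d = ((n : ℝ) ^ 3)⁻¹ := by
    rw [hd, Real.exp_neg, ← hexp 3]
    norm_cast
  have hd1 : d ≤ 1 := Real.exp_le_one_iff.2 (by linarith)
  have hdm : ∀ m : ℕ, m ≤ 2 * n → 1 + 2 * d * m ≤ 1 + 1 / n := by
    intro m hm
    have hm' : (m : ℝ) ≤ 2 * n := by exact_mod_cast hm
    rw [hd', add_le_add_iff_left, le_div_iff₀ hn0]
    calc 2 * ((n : ℝ) ^ 3)⁻¹ * m * n ≤ 2 * ((n : ℝ) ^ 3)⁻¹ * (2 * n) * n := by gcongr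
      _ = 4 / n := by field_simp; ring
      _ ≤ 1 := by rw [div_le_one hn0]; exact hn4
  have ha_hi : 0 < a_hi := ha_lo.trans_le ((ha 0).1.trans (ha 0).2)
  have hJ0 : (0 : ℝ) < J := by exact_mod_cast hJ
  have hω_hi : 0 < ω_hi :=
    lt_of_lt_of_le (by positivity) ((hω ⟨0, hJ⟩).1.trans (hω ⟨0, hJ⟩).2)
  have hJb : Real.exp (-(|b| * ℓ)) ≤ (J : ℝ) ^ (-b) := by
    have hlJ : 0 ≤ Real.log J := Real.log_nonneg (by exact_mod_cast hJ)
    have hlJn : Real.log J ≤ ℓ := Real.log_le_log hJ0 (by exact_mod_cast hJn)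
    rw [Real.rpow_def_of_pos hJ0, Real.exp_le_exp]
    nlinarith [le_abs_self b, abs_nonneg b]
  have hτ2 : ((n : ℝ) ^ 2)⁻¹ ≤ 1 / 2 := by
    rw [one_div]
    exact inv_anti₀ (by norm_num) (by nlinarith)
  have hdpow : ∀ s : ℝ, d ^ s * d = Real.exp (-(3 * (s + 1) * ℓ)) := fun s => by
    rw [hd, ← Real.exp_mul, ← Real.exp_add]
    congr 1
    ring
  have hmass := le_prior_dominating (n := n) (c := c) (a := a) (ω := ω) (H := H) hk
    (q := 1 + 1 / (n : ℝ)) (by simpa using hn0)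
    (by rw [show (2 : ℝ) = 1 + 1 by norm_num, add_le_add_iff_left, div_le_one hn0]; linarith)
    (inv_pos.2 (pow_pos hn0 2)) hτ2 hβ₀ hw₀ hθ₀ ha_lo ha hω_pos
    (ω_lo := ω_lo * Real.exp (-(|b| * ℓ))) (by positivity)
    (fun j => ⟨(mul_le_mul_of_nonneg_left hJb hω_lo.le).trans (hω j).1, (hω j).2⟩)
    (Real.exp_pos _) hd1 (hdm (k + 1) (by omega)) (hdm J (by omega)) ht hC hH
  -- each factor of the prior mass is a power of `n`
  have f1 : Real.exp (-((1 + 3 * (a_hi + 1)) * ℓ)) ≤ a_lo * gammaConst a_hi * d ^ a_hi * d := by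
    rw [mul_assoc (a_lo * _), hdpow]
    calc Real.exp (-((1 + 3 * (a_hi + 1)) * ℓ))
        = Real.exp (-ℓ) * Real.exp (-(3 * (a_hi + 1) * ℓ)) := by
          rw [← Real.exp_add]; congr 1; ring
      _ ≤ _ := by gcongr
  have f2 : Real.exp (-((1 + |b| + 3 * (ω_hi + 1)) * ℓ)) ≤
      ω_lo * Real.exp (-(|b| * ℓ)) * gammaConst ω_hi * d ^ ω_hi * d := by
    rw [mul_assoc (ω_lo * _ * _), hdpow, mul_right_comm ω_lo]
    calc Real.exp (-((1 + |b| + 3 * (ω_hi + 1)) * ℓ))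
        = Real.exp (-ℓ) * Real.exp (-(|b| * ℓ)) * Real.exp (-(3 * (ω_hi + 1) * ℓ)) := by
          rw [← Real.exp_add, ← Real.exp_add]; congr 1; ring
      _ ≤ _ := by gcongr
  have f3 : Real.exp (-((1 + 3 * t) * ℓ)) ≤
      C * (((n : ℝ) ^ 2)⁻¹ * (1 + 1 / (n : ℝ) - 1)) ^ t := by
    have e : ((n : ℝ) ^ 2)⁻¹ * (1 + 1 / (n : ℝ) - 1) = d := by
      rw [hd']
      field_simp
      ring
    rw [e, hd, ← Real.exp_mul]
    calc Real.exp (-((1 + 3 * t) * ℓ)) = Real.exp (-ℓ) * Real.exp (-(3 * ℓ) * t) := by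
          rw [← Real.exp_add]; congr 1; ring
      _ ≤ _ := by gcongr
  have f4 : Real.exp (-(c * J * ℓ)) ≤ ((n : ℝ) ^ c - 1) * (n : ℝ) ^ (-(c * J)) := by
    rw [hexp (-(c * J)), show -(c * J * ℓ) = -(c * J) * ℓ by ring]
    exact le_mul_of_one_le_left (Real.exp_pos _).le (by linarith)
  have f5 : Real.exp (-3) ≤ (((1 + 1 / (n : ℝ)) ^ 3)⁻¹) ^ n := by
    have h1 : 1 + 1 / (n : ℝ) ≤ Real.exp (1 / n) := by
      linarith [Real.add_one_le_exp (1 / (n : ℝ))]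
    rw [inv_pow, Real.exp_neg]
    refine inv_anti₀ (by positivity) ?_
    calc ((1 + 1 / (n : ℝ)) ^ 3) ^ n ≤ (Real.exp (1 / n) ^ 3) ^ n := by gcongr
      _ = Real.exp 3 := by
        rw [← Real.exp_nat_mul, ← Real.exp_nat_mul]
        congr 1
        push_cast
        field_simp
  refine le_trans ?_ (mul_le_mul' (ENNReal.ofReal_le_ofReal f5)
    (le_trans (mul_le_mul' (pow_le_pow_left₀ zero_le (ENNReal.ofReal_le_ofReal f1) _)
      (mul_le_mul' ((ENNReal.ofReal_le_ofReal f4).trans_eq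
          (by rw [compWeight, if_neg (by omega)]))
        (mul_le_mul' (pow_le_pow_left₀ zero_le (ENNReal.ofReal_le_ofReal f2) _)
          (pow_le_pow_left₀ zero_le (ENNReal.ofReal_le_ofReal f3) _)))) hmass))
  simp only [← ENNReal.ofReal_pow (Real.exp_pos _).le, ← Real.exp_nat_mul,
    ← ENNReal.ofReal_mul (Real.exp_pos _).le, ← Real.exp_add]
  refine ENNReal.ofReal_le_ofReal (Real.exp_le_exp.2 ?_)
  have hm1 : (k : ℝ) ≤ (max k J : ℕ) := by exact_mod_cast le_max_left k J
  have hm2 : (J : ℝ) ≤ (max k J : ℕ) := by exact_mod_cast le_max_right k J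
  have hm3 : (1 : ℝ) ≤ (max k J : ℕ) := by exact_mod_cast hk.trans (le_max_left k J)
  generalize ((max k J : ℕ) : ℝ) = m at hm1 hm2 hm3 ⊢
  have hb := abs_nonneg b
  have g0 : 3 ≤ 3 * (m * ℓ) := by nlinarith
  have g1 : ((k + 1 : ℕ) : ℝ) * ((1 + 3 * (a_hi + 1)) * ℓ) ≤
      2 * (1 + 3 * (a_hi + 1)) * (m * ℓ) := by
    push_cast
    calc ((k : ℝ) + 1) * ((1 + 3 * (a_hi + 1)) * ℓ) ≤ (2 * m) * ((1 + 3 * (a_hi + 1)) * ℓ) := by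
          gcongr
          linarith
      _ = _ := by ring
  have g2 : (J : ℝ) * (c * ℓ) ≤ m * (c * ℓ) := by gcongr
  have g3 : (J : ℝ) * ((1 + |b| + 3 * (ω_hi + 1)) * ℓ) ≤
      m * ((1 + |b| + 3 * (ω_hi + 1)) * ℓ) := by gcongr
  have g4 : (J : ℝ) * ((1 + 3 * t) * ℓ) ≤ m * ((1 + 3 * t) * ℓ) := by gcongr
  linarith

/-- The indices of the bracketing functions: grid points for `β`, the weights and the support
points, with at most `L` support points. -/
abbrev BracketIndex (k L N : ℕ) : Type :=
  Σ J : Fin (L + 1), (Fin (k + 1) → Fin (N + 1)) × (Fin J → Fin (N + 1)) × (Fin J → Fin (N + 1))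

theorem card_bracketIndex_le (k L N : ℕ) :
    Fintype.card (BracketIndex k L N) ≤ (L + 1) * (N + 1) ^ (k + 1 + 2 * L) := by
  rw [Fintype.card_sigma]
  calc ∑ J : Fin (L + 1), Fintype.card ((Fin (k + 1) → Fin (N + 1)) ×
        (Fin (J : ℕ) → Fin (N + 1)) × (Fin (J : ℕ) → Fin (N + 1)))
      ≤ ∑ _J : Fin (L + 1), (N + 1) ^ (k + 1 + 2 * L) := by
        refine Finset.sum_le_sum fun J _ => ?_
        simp only [Fintype.card_prod, Fintype.card_fun, Fintype.card_fin]
        rw [← pow_add, ← pow_add]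
        exact Nat.pow_le_pow_right (by omega) (by have := J.2; omega)
    _ = _ := by simp

theorem card_bracketIndex_le_exp {k m Λ n : ℕ} (hn : 4 ≤ n) (hk : k ≤ m) (hm : 1 ≤ m)
    (hlog : 1 ≤ Real.log n) :
    (Fintype.card (BracketIndex k (Λ * m) (n ^ 6)) : ℝ≥0∞) ≤
      ENNReal.ofReal (Real.exp ((14 + 15 * Λ) * (m * Real.log n))) := by
  set ℓ := Real.log n with hℓ
  have hn0 : (0 : ℝ) < n := by
    have : (4 : ℝ) ≤ n := by exact_mod_cast hn
    linarith
  have hN : n ^ 6 + 1 ≤ n ^ 7 := by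
    have : 1 ≤ n ^ 6 := Nat.one_le_pow _ _ (by omega)
    calc n ^ 6 + 1 ≤ n ^ 6 * 4 := by omega
      _ ≤ n ^ 6 * n := Nat.mul_le_mul_left _ hn
      _ = n ^ 7 := by ring
  have h1 : (Fintype.card (BracketIndex k (Λ * m) (n ^ 6)) : ℝ) ≤
      (Λ * m + 1) * ((n : ℝ) ^ 7) ^ (2 * m + 2 * (Λ * m)) := by
    have h := (card_bracketIndex_le k (Λ * m) (n ^ 6)).trans (Nat.mul_le_mul_left _
      ((Nat.pow_le_pow_left hN _).trans (Nat.pow_le_pow_right (n := n ^ 7)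
        (j := 2 * m + 2 * (Λ * m)) (Nat.pos_of_ne_zero (by positivity)) (by omega))))
    exact_mod_cast h
  have h2 : (n : ℝ) = Real.exp ℓ := (Real.exp_log hn0).symm
  have h3 : ((Λ : ℝ) * m + 1) ≤ Real.exp (Λ * m * ℓ) := by
    refine (Real.add_one_le_exp _).trans (Real.exp_le_exp.2 ?_)
    exact le_mul_of_one_le_right (by positivity) hlog
  rw [← ENNReal.ofReal_natCast]
  refine ENNReal.ofReal_le_ofReal (h1.trans ?_)
  calc ((Λ : ℝ) * m + 1) * ((n : ℝ) ^ 7) ^ (2 * m + 2 * (Λ * m))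
      ≤ Real.exp (Λ * m * ℓ) * (Real.exp ℓ ^ 7) ^ (2 * m + 2 * (Λ * m)) := by
        rw [← h2]
        gcongr
    _ = _ := by
        rw [← Real.exp_nat_mul, ← Real.exp_nat_mul, ← Real.exp_add]
        congr 1
        push_cast
        ring

/-- With mesh `n⁻⁶`, the excess mass of the bracketing functions is at most `n⁻²`. -/
theorem bracket_excess_le {n : ℝ} (hn : 4 ≤ n) {x y : ℝ} (hx : x ≤ n ^ 2)
    (hy0 : 0 ≤ y) (hy : y ≤ n ^ 2) :
    (1 + x / n ^ 6) * ((1 + 1 / (n ^ 6 * (n ^ 2)⁻¹)) * (1 + y / n ^ 6)) ≤ 1 + 1 / n ^ 2 := by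
  have hn0 : 0 < n := by linarith
  set s := (n ^ 2)⁻¹ with hs
  have hs0 : 0 < s := by positivity
  have hs1 : s ≤ 1 / 16 := by
    rw [hs, one_div]
    exact inv_anti₀ (by norm_num) (by nlinarith)
  have e : ∀ z, z ≤ n ^ 2 → z / n ^ 6 ≤ s ^ 2 := by
    intro z hz
    rw [div_le_iff₀ (by positivity), hs]
    calc z ≤ n ^ 2 := hz
      _ = _ := by field_simp
  have e2 : 1 / (n ^ 6 * s) = s ^ 2 := by
    rw [hs]
    field_simp
  have e3 : 1 / n ^ 2 = s := by rw [hs, one_div]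
  rw [e2, e3]
  have hx' := e x hx
  have hy' := e y hy
  calc (1 + x / n ^ 6) * ((1 + s ^ 2) * (1 + y / n ^ 6))
      ≤ (1 + s ^ 2) * ((1 + s ^ 2) * (1 + s ^ 2)) := by gcongr
    _ ≤ 1 + s := by
        have : s ^ 2 ≤ s / 16 := by nlinarith
        nlinarith [mul_nonneg hs0.le hs0.le, pow_pos hs0 3, pow_pos hs0 4]

section FixedSampleSize

variable {k J n : ℕ} {β₀ : Fin (k + 1) → ℝ} {w₀ θ₀ : Fin J → ℝ} {c : ℝ}
  {a : Fin (k + 1) → ℝ} {ω : ∀ J : ℕ, Fin J → ℝ} {H : Measure ℝ} [IsProbabilityMeasure H]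

theorem ae_lintegral_density_le_one (hk : 1 ≤ k) (ha : ∀ j, 0 < a j) (hω : ∀ J j, 0 < ω J j)
    (hH : H (Ioo 0 1)ᶜ = 0) :
    ∀ᵐ ξ ∂(prior n c a ω H), ∫⁻ x, ENNReal.ofReal (ξ.density x) ≤ 1 := by
  have h : ∀ᵐ ξ ∂(prior n c a ω H), ξ ∈ sieve k ⊤ (Ioo 0 1) := prior_compl_sieve_top ha hω H hH
  filter_upwards [h] with ξ hξ
  exact (lintegral_mixDensity_eq_one hk hξ.1 hξ.2.2.1 fun l => (hξ.2.2.2 l).1).le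

/-- The posterior mass beyond the Hellinger distance `√2` vanishes. -/
theorem lintegral_posterior_eq_zero (hk : 1 ≤ k) (hn : 2 ≤ n) (hc : 0 < c) (ha : ∀ j, 0 < a j)
    (hω : ∀ J j, 0 < ω J j) (hH : H (Ioo 0 1)ᶜ = 0) (hβ₀ : β₀ ∈ stdSimplex ℝ (Fin (k + 1)))
    (hw₀ : w₀ ∈ stdSimplex ℝ (Fin J)) (hθ₀ : ∀ l, 0 < θ₀ l) {r : ℝ} (hr : 0 ≤ r)
    (hr2 : 2 < r ^ 2) :
    ∫⁻ x : Fin n → ℝ, posterior (prior n c a ω H) Param.density x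
      {ξ | r ≤ hellinger ξ.density (mixDensity β₀ w₀ θ₀)}
      ∂(Measure.pi fun _ : Fin n => law (mixDensity β₀ w₀ θ₀)) = 0 := by
  have := isProbabilityMeasure_prior hn hc ha hω H
  -- with no brackets, the trivial bound `κ = 0` suffices: `κ⁻¹ = ⊤` multiplies a null set
  have h := lintegral_posterior_le (P := prior n c a ω H) prob_le_one (measurable_density k)
    (ae_lintegral_density_le_one hk ha hω hH) (measurable_mixDensity β₀ w₀ θ₀)
    (lintegral_mixDensity_eq_one hk hβ₀ hw₀ hθ₀) (n := n) (κ := 0) (ρ := 0) ENNReal.zero_ne_top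
    (fun x => by simp) (B := {ξ | r ≤ hellinger ξ.density (mixDensity β₀ w₀ θ₀)})
    (V := sieve k ⊤ (Ioo 0 1)) (ι := Empty) (U := fun i => i.elim) (fun i => i.elim) (by
      rintro ξ ⟨hξr, hξ⟩
      exfalso
      have h1 := hellinger_sq_le_two (f := ξ.density) (integrable_mixDensity _ _ _)
        (integrable_mixDensity β₀ w₀ θ₀) (mixDensity_nonneg hξ.1.1 hξ.2.2.1.1 _)
        (mixDensity_nonneg hβ₀.1 hw₀.1 _)
        (integral_mixDensity_eq_one hk hξ.1 hξ.2.2.1 fun l => (hξ.2.2.2 l).1)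
        (integral_mixDensity_eq_one hk hβ₀ hw₀ hθ₀)
      have h2 : r ^ 2 ≤ hellinger ξ.density (mixDensity β₀ w₀ θ₀) ^ 2 :=
        pow_le_pow_left₀ hr hξr 2
      linarith)
  rw [prior_compl_sieve_top ha hω H hH] at h
  simpa using h

/-- The expected posterior mass of the complement of a Hellinger ball of radius `r`, with the sieve
of at most `L` support points in `[n⁻², 1)` and its brackets on the grid of mesh `n⁻⁶`. -/
theorem lintegral_posterior_hellinger_le (hk : 1 ≤ k) (hn : 4 ≤ n) (hc : 0 < c)
    (ha : ∀ j, 0 < a j) (hω : ∀ J j, 0 < ω J j) (hH : H (Ioo 0 1)ᶜ = 0)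
    (hβ₀ : β₀ ∈ stdSimplex ℝ (Fin (k + 1))) (hw₀ : w₀ ∈ stdSimplex ℝ (Fin J))
    (hθ₀ : ∀ l, 0 < θ₀ l) {r : ℝ} (hr : 0 ≤ r) {L : ℕ} (hkn : k + 1 ≤ n ^ 2) (hLn : L ≤ n ^ 2)
    {κ : ℝ≥0∞} (hκ_top : κ ≠ ⊤)
    (hκ : κ ≤ ENNReal.ofReal ((((1 + 1 / (n : ℝ)) ^ 3)⁻¹) ^ n) * prior n c a ω H
        {ξ | ∀ x, mixDensity β₀ w₀ θ₀ x ≤ (1 + 1 / (n : ℝ)) ^ 3 * ξ.density x}) :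
    ∫⁻ x : Fin n → ℝ, posterior (prior n c a ω H) Param.density x
      {ξ | r ≤ hellinger ξ.density (mixDensity β₀ w₀ θ₀)}
      ∂(Measure.pi fun _ : Fin n => law (mixDensity β₀ w₀ θ₀)) ≤
    Fintype.card (BracketIndex k L (n ^ 6)) * κ⁻¹ ^ (1 / 2 : ℝ) *
      ENNReal.ofReal (Real.exp (1 / n - r ^ 2 / 2)) ^ n +
    κ⁻¹ * prior n c a ω H (sieve k L (Ico ((n : ℝ) ^ 2)⁻¹ 1))ᶜ := by
  have hn4 : (4 : ℝ) ≤ n := by exact_mod_cast hn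
  have hn0 : (0 : ℝ) < n := by linarith
  have := isProbabilityMeasure_prior (n := n) (by omega) hc ha hω H
  refine lintegral_posterior_le (P := prior n c a ω H) prob_le_one (measurable_density k)
    (ae_lintegral_density_le_one hk ha hω hH) (measurable_mixDensity β₀ w₀ θ₀)
    (lintegral_mixDensity_eq_one hk hβ₀ hw₀ hθ₀) hκ_top
    (fun x => (mul_le_mul_left hκ _).trans (mul_prod_le_lintegral (measurable_density k)
      (by positivity) x))
    (U := fun i : BracketIndex k L (n ^ 6) =>
      bracket (n ^ 6) (1 + 1 / (((n ^ 6 : ℕ) : ℝ) * ((n : ℝ) ^ 2)⁻¹)) i.2)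
    (fun i => measurable_mixDensity _ _ _) ?_
  rintro ⟨β, J', w, θ⟩ ⟨hξr, hβ, hJL, hw, hθ⟩
  dsimp only at hβ hJL hw hθ
  change r ≤ hellinger (mixDensity β w θ) (mixDensity β₀ w₀ θ₀) at hξr
  change ∃ i, (∀ x, mixDensity β w θ x ≤ _) ∧ _
  have hJL' : J' ≤ L := by exact_mod_cast hJL
  have hτ : (0 : ℝ) < ((n : ℝ) ^ 2)⁻¹ := by positivity
  obtain ⟨i, hi, hi1⟩ := exists_bracket hk (N := n ^ 6) (by positivity) hτ hβ hw hθ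
  refine ⟨⟨⟨J', by omega⟩, i⟩, hi, ?_⟩
  have hexc : ∫ x, bracket (n ^ 6) (1 + 1 / (((n ^ 6 : ℕ) : ℝ) * ((n : ℝ) ^ 2)⁻¹)) i x ≤
      1 + 1 / (n : ℝ) ^ 2 := by
    refine hi1.trans ?_
    push_cast
    exact bracket_excess_le hn4 (by exact_mod_cast hkn) (by positivity)
      (by exact_mod_cast hJL'.trans hLn)
  refine (lintegral_sqrt_mul_le hn0 (integrable_mixDensity _ _ _) (integrable_mixDensity β w θ)
    (integrable_mixDensity β₀ w₀ θ₀) hi (mixDensity_nonneg hβ.1 hw.1 _)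
    (mixDensity_nonneg hβ₀.1 hw₀.1 _)
    (integral_mixDensity_eq_one hk hβ hw fun l => hτ.trans_le (hθ l).1)
    (integral_mixDensity_eq_one hk hβ₀ hw₀ hθ₀) hexc).trans (ENNReal.ofReal_le_ofReal ?_)
  have h2 : r ^ 2 ≤ hellinger (mixDensity β w θ) (mixDensity β₀ w₀ θ₀) ^ 2 :=
    pow_le_pow_left₀ hr hξr 2
  have h3 := Real.add_one_le_exp (1 / (n : ℝ) - r ^ 2 / 2)
  linarith

end FixedSampleSize

/-! ### Asymptotics -/

/-- The prior mass outside the sieve with `Λ m` support points in `[n⁻², 1)`. -/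
theorem prior_compl_sieve_le_exp {k m n Λ : ℕ} (hn : 4 ≤ n) {c : ℝ} (hc : 0 < c)
    {a : Fin (k + 1) → ℝ} (ha : ∀ j, 0 < a j) {ω : ∀ J : ℕ, Fin J → ℝ} (hω : ∀ J j, 0 < ω J j)
    {H : Measure ℝ} [IsProbabilityMeasure H] {p : ℝ → ℝ} {C t D : ℝ} (hC : 0 < C) (ht : 0 < t)
    (hD : 0 ≤ D)
    (hH : H = (volume.restrict (Ioo (0 : ℝ) 1)).withDensity fun θ => ENNReal.ofReal (p θ))
    (hp : ∀ θ, 0 < θ → θ < ((n : ℝ) ^ 2)⁻¹ → p θ ≤ C * Real.exp (-t / θ))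
    (hΛ : D ≤ c * Λ) (hT : m * Real.log n ≤ n) (hmn : m ≤ n) (hnC : Λ * C ≤ n)
    (hnt : D + 2 ≤ t * n) :
    prior n c a ω H (sieve k ((Λ * m : ℕ) : ℕ∞) (Ico ((n : ℝ) ^ 2)⁻¹ 1))ᶜ ≤
      ENNReal.ofReal (2 * Real.exp (-(D * (m * Real.log n)))) := by
  have hn4 : (4 : ℝ) ≤ n := by exact_mod_cast hn
  have hn0 : (0 : ℝ) < n := by linarith
  have hτ1 : ((n : ℝ) ^ 2)⁻¹ ≤ 1 := inv_le_one_of_one_le₀ (by nlinarith)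
  have hm0 : (0 : ℝ) ≤ m := by positivity
  have hℓ : 0 ≤ Real.log n := Real.log_nonneg (by linarith)
  refine (prior_compl_sieve_le_add (by omega) hc ha hω H (Λ * m) measurableSet_Ico).trans ?_
  rw [two_mul, ENNReal.ofReal_add (Real.exp_pos _).le (Real.exp_pos _).le]
  refine add_le_add ?_ (ENNReal.ofReal_le_ofReal ?_)
  · refine (mul_le_mul_right (measure_compl_Ico_le hτ1 hC.le ht.le hH hp) _).trans ?_
    rw [← ENNReal.ofReal_natCast, ← ENNReal.ofReal_mul (by positivity)]
    refine ENNReal.ofReal_le_ofReal ?_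
    have hmn' : (m : ℝ) ≤ n := by exact_mod_cast hmn
    have e1 : (n : ℝ) ≤ Real.exp n := by linarith [Real.add_one_le_exp (n : ℝ)]
    calc ((Λ * m : ℕ) : ℝ) * (C * Real.exp (-t / ((n : ℝ) ^ 2)⁻¹))
        = Λ * C * m * Real.exp (-t / ((n : ℝ) ^ 2)⁻¹) := by
          push_cast
          ring
      _ ≤ Real.exp n * Real.exp n * Real.exp (-t / ((n : ℝ) ^ 2)⁻¹) := by
          have := hnC.trans e1
          have := hmn'.trans e1
          gcongr
      _ = Real.exp (n * (2 - t * n)) := by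
          rw [← Real.exp_add, ← Real.exp_add, div_inv_eq_mul]
          congr 1
          ring
      _ ≤ Real.exp (n * (-D)) := by
          gcongr
          linarith
      _ ≤ Real.exp (-(D * (m * Real.log n))) := by
          rw [Real.exp_le_exp]
          nlinarith
  · rw [Real.rpow_def_of_pos hn0, Real.exp_le_exp]
    push_cast
    have := mul_le_mul_of_nonneg_right hΛ (mul_nonneg hm0 hℓ)
    linarith

/-- Collecting the exponents: `T = n ε²`, the prior mass near the truth is `exp (-D T)`, the
number of brackets `exp (E T)`, and the affinities are `exp (1 / n - r² / 2)`, `r = M ε`. -/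
theorem contraction_bound_le {n : ℕ} (hn : 0 < n) {D E T r : ℝ}
    (hr : 2 * (E + D / 2 + 1) * T ≤ n * r ^ 2) {N S : ℝ≥0∞}
    (hN : N ≤ ENNReal.ofReal (Real.exp (E * T)))
    (hS : S ≤ ENNReal.ofReal (2 * Real.exp (-((D + 1) * T)))) :
    N * (ENNReal.ofReal (Real.exp (-(D * T))))⁻¹ ^ (1 / 2 : ℝ) *
      ENNReal.ofReal (Real.exp (1 / n - r ^ 2 / 2)) ^ n +
      (ENNReal.ofReal (Real.exp (-(D * T))))⁻¹ * S ≤ ENNReal.ofReal (5 * Real.exp (-T)) := by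
  have hn0 : (0 : ℝ) < n := by exact_mod_cast hn
  rw [← ENNReal.ofReal_inv_of_pos (Real.exp_pos _), ← Real.exp_neg, neg_neg,
    ENNReal.ofReal_rpow_of_pos (Real.exp_pos _), ← Real.exp_mul,
    ← ENNReal.ofReal_pow (Real.exp_pos _).le, ← Real.exp_nat_mul]
  have h1 : N * ENNReal.ofReal (Real.exp (D * T * (1 / 2))) *
      ENNReal.ofReal (Real.exp (n * (1 / n - r ^ 2 / 2))) ≤
        ENNReal.ofReal (3 * Real.exp (-T)) := by
    refine (mul_le_mul_left (mul_le_mul_left hN _) _).trans ?_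
    rw [← ENNReal.ofReal_mul (Real.exp_pos _).le, ← Real.exp_add,
      ← ENNReal.ofReal_mul (Real.exp_pos _).le, ← Real.exp_add]
    refine ENNReal.ofReal_le_ofReal ?_
    calc Real.exp (E * T + D * T * (1 / 2) + n * (1 / n - r ^ 2 / 2)) ≤ Real.exp (1 + -T) := by
          rw [Real.exp_le_exp, mul_sub, mul_one_div_cancel hn0.ne']
          linarith
      _ ≤ 3 * Real.exp (-T) := by
          rw [Real.exp_add]
          gcongr
          linarith [Real.exp_one_lt_d9]
  have h2 : ENNReal.ofReal (Real.exp (D * T)) * S ≤ ENNReal.ofReal (2 * Real.exp (-T)) := by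
    refine (mul_le_mul_right hS _).trans ?_
    rw [← ENNReal.ofReal_mul (Real.exp_pos _).le]
    refine ENNReal.ofReal_le_ofReal (le_of_eq ?_)
    rw [mul_left_comm, ← Real.exp_add]
    congr 2
    ring
  refine (add_le_add h1 h2).trans_eq ?_
  rw [← ENNReal.ofReal_add (by positivity) (by positivity)]
  congr 1
  ring

end KMonotone

open KMonotone in
theorem theorem3
    -- constants in the hypotheses
    (t₂ t₃ C₂ C₃ A a_lo a_hi ω_lo ω_hi b : ℝ)
    (ht₂ : 0 < t₂) (ht₃ : 0 < t₃) (hC₂ : 0 < C₂) (hC₃ : 0 < C₃)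
    (ha_lo : 0 < a_lo) (hω_lo : 0 < ω_lo) :
    ∃ cstar : ℝ, 0 < cstar ∧ ∀ c : ℝ, cstar ≤ c →
      -- orders and numbers of components, possibly growing with the sample size `n`
      ∀ (k J₀ : ℕ → ℕ), (∀ n, 1 ≤ k n) → (∀ n, 1 ≤ J₀ n) →
      (∀ᶠ n : ℕ in atTop, max (Real.log (k n)) (Real.log (J₀ n)) ≤ A * Real.log n) →
      -- the true densities
      ∀ (β₀ : ∀ n, Fin (k n + 1) → ℝ) (w₀ θ₀ : ∀ n, Fin (J₀ n) → ℝ),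
      (∀ n, β₀ n ∈ stdSimplex ℝ (Fin (k n + 1))) →
      (∀ n, w₀ n ∈ stdSimplex ℝ (Fin (J₀ n))) →
      (∀ n l, θ₀ n l ∈ Ioo (0 : ℝ) 1) →
      (∀ n, 0 < β₀ n 0) →
      -- (holds automatically if the support points do not depend on `n`)
      (∀ᶠ n : ℕ in atTop, ∀ l, ((n : ℝ) ^ 2)⁻¹ ≤ θ₀ n l) →
      -- the Dirichlet parameters
      ∀ (a : ∀ k : ℕ, Fin (k + 1) → ℝ) (ω : ∀ J : ℕ, Fin J → ℝ),
      (∀ k j, 0 < a k j) → (∀ J j, 0 < ω J j) →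
      (∀ᶠ n : ℕ in atTop, ∀ j, a_lo ≤ a (k n) j ∧ a (k n) j ≤ a_hi) →
      (∀ᶠ n : ℕ in atTop, ∀ j,
        ω_lo * (J₀ n : ℝ) ^ (-b) ≤ ω (J₀ n) j ∧ ω (J₀ n) j ≤ ω_hi) →
      -- the law `H` of the support points, with its density on `(0, 1)`
      ∀ (H : ℕ → Measure ℝ) (pH : ℕ → ℝ → ℝ),
      (∀ n, IsProbabilityMeasure (H n)) →
      (∀ n, Measurable (pH n)) → (∀ n θ, 0 ≤ pH n θ) →
      (∀ n, H n =
        (volume.restrict (Ioo (0 : ℝ) 1)).withDensity fun θ => ENNReal.ofReal (pH n θ)) →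
      (∀ᶠ n : ℕ in atTop, ∀ u v : ℝ, ((n : ℝ) ^ 2)⁻¹ ≤ u → u < v → v ≤ 1 →
        ENNReal.ofReal (C₂ * (v - u) ^ t₂) ≤ H n (Ioo u v)) →
      (∀ᶠ n : ℕ in atTop, ∀ θ : ℝ, 0 < θ → θ < ((n : ℝ) ^ 2)⁻¹ →
        pH n θ ≤ C₃ * Real.exp (-t₃ / θ)) →
      ContractsAt k (fun n => prior n c (a (k n)) ω (H n))
        (fun n => mixDensity (β₀ n) (w₀ n) (θ₀ n))
        (fun n => √(((max (k n) (J₀ n) : ℕ) : ℝ) * Real.log n / n)) := by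
  -- any `c > 0` makes the tail of the number of support points light enough
  refine ⟨1, one_pos, fun c hc k J₀ hk hJ _ β₀ w₀ θ₀ hβ₀ hw₀ hθ₀ _ hθn a ω ha hω haE hωE H pH
    hHprob _ _ hH hH2 hH3 => ?_⟩
  have hc0 : 0 < c := by linarith
  intro M hM
  set C₀ : ℝ := 2 * (1 + 3 * (a_hi + 1)) + c + (1 + |b| + 3 * (ω_hi + 1)) +
    (1 + 3 * t₂) + 3 with hC₀
  set D : ℝ := |C₀| with hD
  have hD0 : 0 ≤ D := abs_nonneg _
  obtain ⟨Λ, hΛ⟩ := exists_nat_ge ((D + 1) / c)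
  have hΛ' : D + 1 ≤ c * Λ := by rwa [div_le_iff₀' hc0] at hΛ
  set E : ℝ := 14 + 15 * Λ with hE
  have hE0 : 0 ≤ E := by positivity
  have hlog : Tendsto (fun n : ℕ => Real.log n) atTop atTop :=
    Real.tendsto_log_atTop.comp tendsto_natCast_atTop_atTop
  have hsmall : ∀ x : ℝ, 0 < x → ∀ᶠ n : ℕ in atTop, Real.exp (-Real.log n) ≤ x := fun x hx =>
    (Real.tendsto_exp_neg_atTop_nhds_zero.comp hlog).eventually_le_const hx
  have hlarge : ∀ x : ℝ, ∀ᶠ n : ℕ in atTop, x ≤ n := fun x =>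
    tendsto_natCast_atTop_atTop.eventually_ge_atTop x
  have hpow : ∀ᶠ n : ℕ in atTop, 2 ≤ (n : ℝ) ^ c :=
    ((tendsto_rpow_atTop hc0).comp tendsto_natCast_atTop_atTop).eventually_ge_atTop 2
  have hlim : Tendsto (fun n : ℕ => ENNReal.ofReal (5 / n)) atTop (𝓝 0) := by
    have := ENNReal.tendsto_ofReal (tendsto_const_div_atTop_nhds_zero_nat (5 : ℝ))
    rwa [ENNReal.ofReal_zero] at this
  refine tendsto_of_tendsto_of_tendsto_of_le_of_le' tendsto_const_nhds hlim
    (Eventually.of_forall fun n => zero_le) ?_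
  filter_upwards [hθn, haE, hωE, hH2, hH3, hpow,
    hsmall _ (mul_pos ha_lo (gammaConst_pos a_hi)), hsmall _ (mul_pos hω_lo (gammaConst_pos ω_hi)),
    hsmall C₂ hC₂, hlog.eventually_ge_atTop 1, eventually_ge_atTop 4, eventually_ge_atTop Λ,
    hlarge (Λ * C₃), hlarge ((D + 1 + 2) / t₃), hM.eventually_ge_atTop 2,
    hM.eventually_ge_atTop (2 * (E + D / 2 + 1))]
    with n nθ na nω nH2 nH3 nc n1 n2 n3 nlog n4 nΛ nC nt nM2 nM
  have := hHprob n
  have hn4 : (4 : ℝ) ≤ n := by exact_mod_cast n4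
  have hn0 : (0 : ℝ) < n := by linarith
  set m : ℕ := max (k n) (J₀ n) with hm
  set T : ℝ := (m : ℝ) * Real.log n with hT
  have hm1 : 1 ≤ m := (hk n).trans (le_max_left _ _)
  have hm1' : (1 : ℝ) ≤ m := by exact_mod_cast hm1
  have hTℓ : Real.log n ≤ T := le_mul_of_one_le_left (by linarith) hm1'
  have hmT : (m : ℝ) ≤ T := le_mul_of_one_le_right (by linarith) nlog
  have hT0 : 0 ≤ T := by linarith
  have hr0 : 0 ≤ M n * √(T / n) := mul_nonneg (by linarith) (Real.sqrt_nonneg _)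
  have hr2 : (n : ℝ) * (M n * √(T / n)) ^ 2 = M n ^ 2 * T := by
    rw [mul_pow, Real.sq_sqrt (div_nonneg hT0 hn0.le)]
    field_simp
  have hHc : H n (Ioo 0 1)ᶜ = 0 := by
    rw [hH n]
    refine withDensity_absolutelyContinuous _ _ ?_
    rw [Measure.restrict_apply measurableSet_Ioo.compl, compl_inter_self, measure_empty]
  rcases lt_or_ge 2 ((M n * √(T / n)) ^ 2) with hbig | hle
  · rw [lintegral_posterior_eq_zero (hk n) (by omega) hc0 (ha _) hω hHc (hβ₀ n) (hw₀ n)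
      (fun l => (hθ₀ n l).1) hr0 hbig]
    exact zero_le
  -- in the remaining case `max k J₀` is at most `n`
  · have hTn : T ≤ n := by
      have h1 : M n ^ 2 * T ≤ n * 2 := hr2 ▸ mul_le_mul_of_nonneg_left hle hn0.le
      have h2 : 4 ≤ M n ^ 2 := by nlinarith
      nlinarith
    have hmn : m ≤ n := by exact_mod_cast hmT.trans hTn
    have hkn : k n ≤ n := (le_max_left _ _).trans hmn
    have hJn : J₀ n ≤ n := (le_max_right _ _).trans hmn
    have hmass := exp_le_prior_dominating (hk n) (hJ n) n4 hkn hJn (hβ₀ n) (hw₀ n)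
      (fun l => ⟨nθ l, (hθ₀ n l).2⟩) hc0 (H := H n) ha_lo na hω hω_lo nω ht₂ hC₂ nH2 n1 n2 n3 nc nlog
    have hκ : ENNReal.ofReal (Real.exp (-(D * T))) ≤ ENNReal.ofReal (Real.exp (-(C₀ * T))) := by
      refine ENNReal.ofReal_le_ofReal (Real.exp_le_exp.2 ?_)
      have := mul_le_mul_of_nonneg_right (le_abs_self C₀) hT0
      linarith
    refine (lintegral_posterior_hellinger_le (hk n) n4 hc0 (ha _) hω hHc (hβ₀ n) (hw₀ n)
      (fun l => (hθ₀ n l).1) hr0 (L := Λ * m) (by nlinarith) (by nlinarith)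
      ENNReal.ofReal_ne_top (hκ.trans hmass)).trans ?_
    refine (contraction_bound_le (by omega) (E := E) ?_
      (card_bracketIndex_le_exp n4 (le_max_left _ _) hm1 nlog)
      (prior_compl_sieve_le_exp n4 hc0 (ha _) hω hC₃ ht₃ (by linarith) (hH n) nH3 hΛ' hTn hmn nC
        ((div_le_iff₀' ht₃).1 nt))).trans ?_
    · rw [hr2]
      refine mul_le_mul_of_nonneg_right (nM.trans ?_) hT0
      nlinarith
    · refine ENNReal.ofReal_le_ofReal ?_
      calc 5 * Real.exp (-T) ≤ 5 * Real.exp (-Real.log n) := by gcongr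
        _ = 5 / n := by rw [Real.exp_neg, Real.exp_log hn0]; rfl
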